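/- Let $g\colon[0,1]\to[0,\infty)$ be piecewise $C^2$: there is a partition $0=p_0<p_1<\dots<p_n=1$ such that $g$ is $C^2$ on each $(p_{i},p_{i+1})$, and $g,g',g''$ have finite one-sided limits at the endpoints of each of these intervals (in particular $g$ is bounded). Suppose that for some $\varepsilon>0$ we have $g(x)\ge\varepsilon$ for all $x\in[0,1]$ with $x\ge 1-\varepsilon$. Let $T$ be a random variable with $$\mathbb E\,e^{\theta T}=\exp\Big(\int_0^1(e^{\theta x}-1)\,g(x)\,dx\Big)\qquad\text{for all }\theta\in\mathbb R .$$ For $\beta\in\mathbb R$ let $T_\beta$ be distributed as the Cramér $\beta$-tilt of $T$, that is, $\mathbb P(T_\beta\in dt)=e^{\beta t}\,\mathbb P(T\in dt)/\mathbb E\,e^{\beta T}$. Let $E_\beta$ and $\sigma_\beta^2$ be the mean and the variance of $T_\beta$, with $\sigma_\beta\geq 0$, and let $Y=Y_\beta=(T_\beta-E_\beta)/\sigma_\beta$. Then $E_\beta\to\infty$ as $\beta\to\infty$. Moreover, for every $\beta$, $Y_\beta$ has an atom at $-E_\beta/\sigma_\beta$ and apart from that atom a (defective) density $f_Y=f_{Y_\beta}$,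 which can be chosen continuous off a finite set and at every $y$ with $E_\beta+\sigma_\beta y>1$ (so $f_Y$ is determined up to its values at finitely many points, and $f_Y(0)$ is determined once $E_\beta>1$), such that, as $\beta\to\infty$, $$f_Y(y)=\frac{1}{\sqrt{2\pi}}\,e^{-y^2/2}+O\Big(\frac1{\sqrt{E_\beta}}\Big)\quad\text{uniformly in } y\in\mathbb R, \qquad f_Y(0)=\frac1{\sqrt{2\pi}}+O\Big(\frac1{E_\beta}\Big).$$ -/

import Mathlib

open MeasureTheory ProbabilityTheory Filter Topology Set

noncomputable section

/-- `g` is piecewise `C^k` on `[a, b]`: there are points `a = p 0 < p 1 < ⋯ < p n = b` such that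
`g` is `C^k` on each open interval `(p i, p (i+1))`, and `g` and its first `k` derivatives have
finite one-sided limits at both endpoints of each of these intervals. The values of `g` at the
points `p i` themselves are arbitrary. -/
def PiecewiseC (k : ℕ) (g : ℝ → ℝ) (a b : ℝ) : Prop :=
  ∃ (n : ℕ) (p : Fin (n + 1) → ℝ), StrictMono p ∧ p 0 = a ∧ p (Fin.last n) = b ∧
    ∀ i : Fin n,
      ContDiffOn ℝ k g (Ioo (p i.castSucc) (p i.succ)) ∧
      ∀ j : ℕ, j ≤ k →
        (∃ l : ℝ, Tendsto (iteratedDeriv j g) (𝓝[>] (p i.castSucc)) (𝓝 l)) ∧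
        (∃ l : ℝ, Tendsto (iteratedDeriv j g) (𝓝[<] (p i.succ)) (𝓝 l))

/-- The random variable `T` has the infinitely divisible law with Lévy measure `g(x) dx` on
`[0, 1]`: `E exp(θ T) = exp (∫₀¹ (exp(θ x) - 1) g(x) dx)` for all real `θ`. (The right side is
positive, so this includes the finiteness of the left side.) -/
def HasLevyDensity {Ω : Type*} [MeasurableSpace Ω] (P : Measure Ω) (T : Ω → ℝ) (g : ℝ → ℝ) :
    Prop :=
  AEMeasurable T P ∧
    ∀ θ : ℝ, mgf T P θ = Real.exp (∫ x in (0 : ℝ)..1, (Real.exp (θ * x) - 1) * g x)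

/-- The Cramér `β`-tilt of a law `ν` on the line: `exp(β t) ν(dt) / ∫ exp(β s) ν(ds)`. -/
def cramerTilt (ν : Measure ℝ) (β : ℝ) : Measure ℝ :=
  ν.tilted (fun t => β * t)

/-- The mean `E_β` of the `β`-tilt of `ν`. -/
def tiltMean (ν : Measure ℝ) (β : ℝ) : ℝ :=
  ∫ t, t ∂(cramerTilt ν β)

/-- The standard deviation `σ_β` of the `β`-tilt of `ν`. -/
def tiltSD (ν : Measure ℝ) (β : ℝ) : ℝ :=
  Real.sqrt (variance (fun t : ℝ => t) (cramerTilt ν β))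

/-- The law of `Y_β = (T_β - E_β) / σ_β`, where `T_β` is distributed as the `β`-tilt of `ν`. -/
def standardizedTilt (ν : Measure ℝ) (β : ℝ) : Measure ℝ :=
  (cramerTilt ν β).map (fun t => (t - tiltMean ν β) / tiltSD ν β)

/-- `f` is a defective density of the law `ν`, whose only atom is the point `a`:
`ν = ν{a} δ_a + f(y) dy` with `ν{a} > 0`. -/
def IsDefectiveDensity (ν : Measure ℝ) (a : ℝ) (f : ℝ → ℝ) : Prop :=
  Measurable f ∧ (∀ y, 0 ≤ f y) ∧ 0 < ν {a} ∧
    ν = ν {a} • Measure.dirac a + volume.withDensity (fun y => ENNReal.ofReal (f y))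

end

/-! Tilting by `β` multiplies the Lévy density by `exp(βx)`, so `T_β` is compound Poisson with jump
measure `μ = exp(βx) g(x) dx` on `[0,1]`. Its characteristic function is `exp(φ - λ)`, where `φ =
charFun μ` and `λ` is the mass of `μ` (`charFun_cramerTilt`). The mean and variance are the first
two moments of `μ` (`tiltMean_eq`, `tiltVariance_eq`).

Split by the number of jumps: `exp(φ - λ) = e^{-λ} + e^{-λ} φ + e^{-λ}(exp φ - 1 - φ)`. The first
term is an atom at 0. The second has the density `e^{-λ} exp(βx) g(x)`, which carries all
discontinuities and vanishes beyond 1. The third is integrable, being `O(|φ|²)` while `φ` is square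
integrable (`lintegral_normSq_charFun_le`), so Fourier inversion gives it a continuous density. This
is `compoundPoisson_eq`.

The inversion integral, rescaled by `σ`, is compared with that of `exp(-s²/2)`. On `|s| ≤ πσ` the
logarithm of the standardized characteristic function has real part at most `-(2/π²)s²` and equals
`-s²/2 + O(|s|³/σ)`, with an error `O(1/σ)` after integration. At `y = 0` the cubic term is odd and
integrates to zero, leaving `O(1/σ²)`. For frequencies `|t| ≥ π`, the mass of `μ` in a window of
width `1/β` at 1 forces `Re φ ≤ λ - D` with `D` of order `e^β/β³` (`re_charFun_tiltedJump_le`). Then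
`e^{-D}` and `e^{-λ}` beat every power of `e^β` that occurs, and the tail and the single-jump
density are negligible. Finally `σ² ≤ E ≤ λ`, with `λ = O(e^β/β)` and `σ²` at least a multiple of
`e^β/β`, so powers of `σ` convert to powers of `√E`. -/

/-! ### Fourier inversion for differences of measures. -/

/-- Integrating an exponential against a Gaussian weight is the same as averaging the
characteristic function over a Gaussian shift. -/
lemma integral_cexp_mul_gaussian_weight (ν : Measure ℝ) [IsFiniteMeasure ν] (s : ℝ) :
    ∫ x : ℝ, Complex.exp (s * x * Complex.I) * (Real.exp (-x ^ 2 / 2) : ℂ) ∂ν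
      = ∫ t, charFun ν (s + t) ∂(gaussianReal 0 1) := by
  have h1 : ∀ x : ℝ, (Real.exp (-x ^ 2 / 2) : ℂ)
      = ∫ t : ℝ, Complex.exp (x * t * Complex.I) ∂(gaussianReal 0 1) := by
    intro x
    rw [← charFun_apply_real, charFun_gaussianReal]
    push_cast
    congr 1
    simp
    ring
  simp_rw [h1, charFun_apply_real, ← integral_const_mul]
  rw [integral_integral_swap]
  · refine integral_congr_ae (Eventually.of_forall fun t => integral_congr_ae
      (Eventually.of_forall fun x => ?_))
    simp only
    rw [← Complex.exp_add]
    congr 1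
    push_cast
    ring
  · refine Integrable.mono' (integrable_const (1 : ℝ))
      (Continuous.aestronglyMeasurable (by fun_prop)) (Eventually.of_forall fun p => ?_)
    simp only [Function.uncurry]
    rw [norm_mul, ← Complex.ofReal_mul, ← Complex.ofReal_mul, Complex.norm_exp_ofReal_mul_I,
      Complex.norm_exp_ofReal_mul_I]
    simp

/-- The inverse Fourier integral `(2π)⁻¹ ∫ exp(-iux) ψ(u) du`. -/
noncomputable def fourierInvReal (ψ : ℝ → ℂ) (x : ℝ) : ℂ :=
  (2 * Real.pi : ℝ)⁻¹ * ∫ u : ℝ, Complex.exp ((-(u * x) : ℝ) * Complex.I) * ψ u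

lemma norm_cexp_neg_mul_I_mul (a : ℝ) (z : ℂ) :
    ‖Complex.exp (a * Complex.I) * z‖ = ‖z‖ := by
  rw [norm_mul, Complex.norm_exp_ofReal_mul_I, one_mul]

lemma continuous_fourierInvReal {ψ : ℝ → ℂ} (hψ : Integrable ψ) :
    Continuous (fourierInvReal ψ) := by
  unfold fourierInvReal
  refine continuous_const.mul (continuous_of_dominated (bound := fun u => ‖ψ u‖) ?_ ?_ hψ.norm ?_)
  · intro x
    exact (Continuous.aestronglyMeasurable (by fun_prop)).mul hψ.aestronglyMeasurable
  · intro x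
    exact Eventually.of_forall fun u => (norm_cexp_neg_mul_I_mul _ _).le
  · exact Eventually.of_forall fun u => by fun_prop

lemma norm_fourierInvReal_le (ψ : ℝ → ℂ) (x : ℝ) :
    ‖fourierInvReal ψ x‖ ≤ (2 * Real.pi)⁻¹ * ∫ u, ‖ψ u‖ := by
  unfold fourierInvReal
  rw [norm_mul, Complex.norm_real, Real.norm_of_nonneg (by positivity)]
  gcongr
  refine (norm_integral_le_integral_norm _).trans (le_of_eq ?_)
  exact integral_congr_ae (Eventually.of_forall fun u => norm_cexp_neg_mul_I_mul _ _)

lemma ofReal_re_fourierInvReal {ψ : ℝ → ℂ} (hsymm : ∀ u, ψ (-u) = (starRingEnd ℂ) (ψ u)) (x : ℝ) :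
    ((fourierInvReal ψ x).re : ℂ) = fourierInvReal ψ x := by
  rw [← Complex.conj_eq_iff_re]
  unfold fourierInvReal
  rw [map_mul, Complex.conj_ofReal, ← integral_conj]
  congr 1
  rw [← integral_neg_eq_self]
  refine integral_congr_ae (Eventually.of_forall fun u => ?_)
  simp only [map_mul, hsymm, Complex.conj_conj, ← Complex.exp_conj, Complex.conj_ofReal,
    Complex.conj_I]
  congr 2
  push_cast
  ring

/-- The Fourier transform of a Gaussian-weighted inverse Fourier integral. -/
lemma integral_cexp_mul_gaussian_weight_fourierInvReal {ψ : ℝ → ℂ} (hψ : Integrable ψ) (s : ℝ) :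
    ∫ x : ℝ, Complex.exp (s * x * Complex.I) * (Real.exp (-x ^ 2 / 2) : ℂ) * fourierInvReal ψ x
      = ∫ t, ψ (s + t) ∂(gaussianReal 0 1) := by
  have hG : ∀ u : ℝ, ∫ x : ℝ, Complex.exp (s * x * Complex.I) * (Real.exp (-x ^ 2 / 2) : ℂ)
        * Complex.exp ((-(u * x) : ℝ) * Complex.I)
      = (Real.sqrt (2 * Real.pi) * Real.exp (-(u - s) ^ 2 / 2) : ℝ) := by
    intro u
    have h := charFun_gaussianReal (μ := 0) (v := 1) (s - u)
    rw [charFun_apply_real, integral_gaussianReal_eq_integral_smul (by simp)] at h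
    have h2 : ∀ x : ℝ, gaussianPDFReal 0 1 x • Complex.exp ((s - u : ℝ) * x * Complex.I)
        = ((Real.sqrt (2 * Real.pi))⁻¹ : ℝ) * (Complex.exp (s * x * Complex.I)
        * (Real.exp (-x ^ 2 / 2) : ℂ) * Complex.exp ((-(u * x) : ℝ) * Complex.I)) := by
      intro x
      rw [gaussianPDFReal, Complex.real_smul]
      simp only [NNReal.coe_one, mul_one, sub_zero]
      push_cast
      rw [mul_assoc, ← Complex.exp_add, mul_assoc, ← Complex.exp_add, ← Complex.exp_add]
      congr 2
      ring
    simp_rw [h2] at h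
    rw [integral_const_mul] at h
    have h3 : (Real.sqrt (2 * Real.pi) : ℂ) ≠ 0 := by
      have : 0 < Real.sqrt (2 * Real.pi) := by positivity
      exact_mod_cast this.ne'
    have h4 : ∀ A B : ℂ, ((Real.sqrt (2 * Real.pi))⁻¹ : ℝ) * A = B →
        A = Real.sqrt (2 * Real.pi) * B := by
      rintro A B rfl
      push_cast
      field_simp
    rw [h4 _ _ h]
    push_cast
    congr 2
    simp
    ring
  calc _ = ∫ x : ℝ, ∫ u : ℝ, (2 * Real.pi : ℝ)⁻¹ * (Complex.exp (s * x * Complex.I)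
        * (Real.exp (-x ^ 2 / 2) : ℂ) * Complex.exp ((-(u * x) : ℝ) * Complex.I) * ψ u) := by
        refine integral_congr_ae (Eventually.of_forall fun x => ?_)
        simp only [fourierInvReal]
        rw [integral_const_mul]
        simp_rw [mul_assoc]
        rw [integral_const_mul, integral_const_mul]
        ring
    _ = ∫ u : ℝ, ∫ x : ℝ, (2 * Real.pi : ℝ)⁻¹ * (Complex.exp (s * x * Complex.I)
        * (Real.exp (-x ^ 2 / 2) : ℂ) * Complex.exp ((-(u * x) : ℝ) * Complex.I) * ψ u) := by
        rw [integral_integral_swap]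
        have hg : Integrable (fun x : ℝ => Real.exp (-x ^ 2 / 2)) := by
          have := integrable_exp_neg_mul_sq (b := 1 / 2) (by norm_num)
          refine this.congr (Eventually.of_forall fun x => ?_)
          simp only
          congr 1
          ring
        refine ((hg.mul_prod hψ.norm).const_mul (2 * Real.pi)⁻¹).mono' ?_
          (Eventually.of_forall fun p => ?_)
        · refine AEStronglyMeasurable.const_mul (AEStronglyMeasurable.mul
            (Continuous.aestronglyMeasurable (by fun_prop)) ?_) _
          exact hψ.aestronglyMeasurable.comp_snd
        · simp only [Function.uncurry]
          rw [norm_mul, norm_mul, norm_mul, norm_mul, ← Complex.ofReal_mul,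
            Complex.norm_exp_ofReal_mul_I, Complex.norm_exp_ofReal_mul_I, Complex.norm_real,
            Complex.norm_real, Real.norm_of_nonneg (by positivity),
            Real.norm_of_nonneg (by positivity)]
          apply le_of_eq
          ring
    _ = ∫ u : ℝ, gaussianPDFReal s 1 u • ψ u := by
        refine integral_congr_ae (Eventually.of_forall fun u => ?_)
        simp only
        rw [integral_const_mul, integral_mul_const, hG, ← mul_assoc, ← Complex.ofReal_mul,
          Complex.real_smul]
        congr 2
        rw [gaussianPDFReal]
        simp only [NNReal.coe_one, mul_one]
        rw [← mul_assoc]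
        congr 1
        have hp : (0 : ℝ) < 2 * Real.pi := by positivity
        rw [inv_mul_eq_div, div_eq_iff hp.ne']
        nth_rw 3 [← Real.mul_self_sqrt hp.le]
        have : Real.sqrt (2 * Real.pi) ≠ 0 := by positivity
        field_simp
    _ = ∫ u, ψ u ∂(gaussianReal s 1) := (integral_gaussianReal_eq_integral_smul (by simp)).symm
    _ = _ := by
        have : gaussianReal s 1 = (gaussianReal 0 1).map (fun t => s + t) := by
          rw [gaussianReal_map_const_add, zero_add]
        rw [this]
        exact integral_map_equiv (MeasurableEquiv.addLeft s) ψ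

lemma integrable_gaussian_weight : Integrable (fun x : ℝ => Real.exp (-x ^ 2 / 2)) := by
  refine (integrable_exp_neg_mul_sq (b := 1 / 2) (by norm_num)).congr
    (Eventually.of_forall fun x => ?_)
  simp only
  congr 1
  ring

lemma charFun_withDensity {ν : Measure ℝ} {w : ℝ → ℝ} (hw : Measurable w) (h0 : ∀ x, 0 ≤ w x)
    (s : ℝ) : charFun (ν.withDensity fun x => ENNReal.ofReal (w x)) s
      = ∫ x : ℝ, Complex.exp (s * x * Complex.I) * (w x : ℂ) ∂ν := by
  rw [charFun_apply_real, integral_withDensity_eq_integral_toReal_smul (by fun_prop)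
    (Eventually.of_forall fun x => by simp)]
  refine integral_congr_ae (Eventually.of_forall fun x => ?_)
  simp only
  rw [ENNReal.toReal_ofReal (h0 x), Complex.real_smul, mul_comm]

/-- Two measures agree as soon as their Gaussian-weighted versions are finite and have the same
characteristic function. -/
lemma Measure.ext_of_charFun_gaussian_weight {μ ν : Measure ℝ}
    [IsFiniteMeasure (μ.withDensity fun x => ENNReal.ofReal (Real.exp (-x ^ 2 / 2)))]
    [IsFiniteMeasure (ν.withDensity fun x => ENNReal.ofReal (Real.exp (-x ^ 2 / 2)))]
    (h : ∀ s : ℝ, ∫ x : ℝ, Complex.exp (s * x * Complex.I) * (Real.exp (-x ^ 2 / 2) : ℂ) ∂μ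
      = ∫ x : ℝ, Complex.exp (s * x * Complex.I) * (Real.exp (-x ^ 2 / 2) : ℂ) ∂ν) : μ = ν := by
  have key : (μ.withDensity fun x => ENNReal.ofReal (Real.exp (-x ^ 2 / 2)))
      = ν.withDensity fun x => ENNReal.ofReal (Real.exp (-x ^ 2 / 2)) := by
    refine Measure.ext_of_charFun (funext fun s => ?_)
    rw [charFun_withDensity (by fun_prop) (fun x => by positivity),
      charFun_withDensity (by fun_prop) (fun x => by positivity), h s]
  have hm : Measurable fun x : ℝ => ENNReal.ofReal (Real.exp (-x ^ 2 / 2)) := by fun_prop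
  have h1 : ∀ x : ℝ, ENNReal.ofReal (Real.exp (-x ^ 2 / 2)) ≠ 0 := fun x => by
    simp [Real.exp_pos]
  have h2 : ∀ x : ℝ, ENNReal.ofReal (Real.exp (-x ^ 2 / 2)) ≠ ⊤ := fun x => by simp
  rw [← withDensity_inv_same (μ := μ) hm (Eventually.of_forall h1) (Eventually.of_forall h2), key,
    withDensity_inv_same (μ := ν) hm (Eventually.of_forall h1) (Eventually.of_forall h2)]

/-- If the characteristic functions of two finite measures differ by an integrable function,
the measures differ by the inverse Fourier integral of that function. -/
theorem add_withDensity_fourierInvReal {ν ρ : Measure ℝ} [IsFiniteMeasure ν] [IsFiniteMeasure ρ]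
    {ψ : ℝ → ℂ} (hψ : Integrable ψ) (h : ∀ t, charFun ν t = charFun ρ t + ψ t) :
    ν + volume.withDensity (fun x => ENNReal.ofReal (-(fourierInvReal ψ x).re))
      = ρ + volume.withDensity (fun x => ENNReal.ofReal (fourierInvReal ψ x).re) := by
  have hψ' : ψ = fun t => charFun ν t - charFun ρ t := funext fun t => by rw [h t]; ring
  have hsymm : ∀ u, ψ (-u) = (starRingEnd ℂ) (ψ u) := by
    intro u
    simp only [hψ', charFun_neg, map_sub]
  set H : ℝ → ℝ := fun x => (fourierInvReal ψ x).re with hH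
  have hHc : Continuous H := Complex.continuous_re.comp (continuous_fourierInvReal hψ)
  set C := (2 * Real.pi)⁻¹ * ∫ u, ‖ψ u‖
  have hHb : ∀ x, |H x| ≤ C := fun x =>
    (Complex.abs_re_le_norm _).trans (norm_fourierInvReal_le ψ x)
  have hC : 0 ≤ C := (abs_nonneg _).trans (hHb 0)
  -- integrals of weighted bounded densities
  have hintg : ∀ s : ℝ, ∀ A : ℝ → ℝ, Continuous A → (∀ x, |A x| ≤ C) →
      Integrable (fun x : ℝ => Complex.exp (s * x * Complex.I) * (Real.exp (-x ^ 2 / 2) : ℂ)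
        * (A x : ℂ)) := by
    intro s A hA hAb
    refine (integrable_gaussian_weight.const_mul C).mono'
      (Continuous.aestronglyMeasurable (by fun_prop)) (Eventually.of_forall fun x => ?_)
    rw [norm_mul, norm_mul, ← Complex.ofReal_mul, Complex.norm_exp_ofReal_mul_I, Complex.norm_real,
      Complex.norm_real, Real.norm_of_nonneg (by positivity), one_mul, mul_comm]
    exact mul_le_mul_of_nonneg_right (hAb x) (by positivity)
  -- `H` is bounded but not known to be integrable, and its sign is unknown. So its negative part
  -- sits on the other side of the identity, and the Gaussian weight makes both sides finite.
  have hfin : ∀ (κ : Measure ℝ) [IsFiniteMeasure κ] (A : ℝ → ℝ), Continuous A →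
      (∀ x, A x ≤ C) → IsFiniteMeasure ((κ + volume.withDensity
        (fun x => ENNReal.ofReal (A x))).withDensity
          fun x => ENNReal.ofReal (Real.exp (-x ^ 2 / 2))) := by
    intro κ _ A hA hAb
    refine ⟨?_⟩
    rw [withDensity_apply _ MeasurableSet.univ, Measure.restrict_univ, lintegral_add_measure,
      lintegral_withDensity_eq_lintegral_mul _ (by fun_prop) (by fun_prop)]
    refine ENNReal.add_lt_top.2 ⟨?_, ?_⟩
    · calc _ ≤ ∫⁻ x, 1 ∂κ := by
            refine lintegral_mono fun x => ?_
            rw [← ENNReal.ofReal_one]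
            refine ENNReal.ofReal_le_ofReal (Real.exp_le_one_iff.2 ?_)
            nlinarith [sq_nonneg x]
        _ < ⊤ := by simp
    · calc _ ≤ ∫⁻ x, ENNReal.ofReal (C * Real.exp (-x ^ 2 / 2)) := by
            refine lintegral_mono fun x => ?_
            simp only [Pi.mul_apply]
            rw [ENNReal.ofReal_mul hC]
            gcongr
            exact hAb x
        _ < ⊤ := (integrable_gaussian_weight.const_mul C).lintegral_lt_top
  have hsplit : ∀ (κ : Measure ℝ) [IsFiniteMeasure κ] (A : ℝ → ℝ), Continuous A →
      (∀ x, |A x| ≤ C) → ∀ s : ℝ,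
      ∫ x : ℝ, Complex.exp (s * x * Complex.I) * (Real.exp (-x ^ 2 / 2) : ℂ)
        ∂(κ + volume.withDensity (fun x => ENNReal.ofReal (A x)))
      = ∫ x : ℝ, Complex.exp (s * x * Complex.I) * (Real.exp (-x ^ 2 / 2) : ℂ) ∂κ
        + ∫ x : ℝ, Complex.exp (s * x * Complex.I) * (Real.exp (-x ^ 2 / 2) : ℂ)
          * ((max (A x) 0 : ℝ) : ℂ) := by
    intro κ _ A hA hAb s
    have hmax : ∀ x, |max (A x) 0| ≤ C := fun x => by
      rw [abs_of_nonneg (le_max_right _ _)]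
      exact max_le ((le_abs_self _).trans (hAb x)) hC
    have hd : ∀ x, ENNReal.ofReal (A x) = ENNReal.ofReal (max (A x) 0) := fun x => by
      rcases le_total (A x) 0 with h | h
      · rw [max_eq_right h, ENNReal.ofReal_of_nonpos h, ENNReal.ofReal_zero]
      · rw [max_eq_left h]
    simp_rw [hd]
    have hm : Measurable fun x => ENNReal.ofReal (max (A x) 0) := by fun_prop
    have e : ∀ x : ℝ, (ENNReal.ofReal (max (A x) 0)).toReal • (Complex.exp (s * x * Complex.I)
        * (Real.exp (-x ^ 2 / 2) : ℂ)) = Complex.exp (s * x * Complex.I)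
        * (Real.exp (-x ^ 2 / 2) : ℂ) * ((max (A x) 0 : ℝ) : ℂ) := fun x => by
      rw [ENNReal.toReal_ofReal (le_max_right _ _), Complex.real_smul, mul_comm]
    rw [integral_add_measure, integral_withDensity_eq_integral_toReal_smul hm
      (Eventually.of_forall fun x => by simp)]
    · simp_rw [e]
    · refine (integrable_const (1 : ℝ)).mono' (Continuous.aestronglyMeasurable (by fun_prop))
        (Eventually.of_forall fun x => ?_)
      rw [norm_mul, ← Complex.ofReal_mul, Complex.norm_exp_ofReal_mul_I, Complex.norm_real,
        Real.norm_of_nonneg (by positivity), one_mul]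
      refine Real.exp_le_one_iff.2 ?_
      nlinarith [sq_nonneg x]
    · rw [integrable_withDensity_iff_integrable_smul' hm (Eventually.of_forall fun x => by simp)]
      simp_rw [e]
      exact hintg s _ (by fun_prop) hmax
  have := hfin ν (fun x => -H x) hHc.neg (fun x => (neg_le_abs _).trans (hHb x))
  have := hfin ρ H hHc (fun x => (le_abs_self _).trans (hHb x))
  refine Measure.ext_of_charFun_gaussian_weight fun s => ?_
  rw [hsplit ν (fun x => -H x) hHc.neg (fun x => by rw [abs_neg]; exact hHb x),
    hsplit ρ H hHc hHb, integral_cexp_mul_gaussian_weight, integral_cexp_mul_gaussian_weight]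
  have hmx : ∀ A : ℝ → ℝ, (∀ x, |A x| ≤ C) → ∀ x, |max (A x) 0| ≤ C := fun A hA x => by
    rw [abs_of_nonneg (le_max_right _ _)]
    exact max_le ((le_abs_self _).trans (hA x)) hC
  -- Positive part minus negative part is `H`, whose weighted transform is the Gaussian average of
  -- `ψ`. That average is also the difference of the averages of the two characteristic functions.
  have h3 : (∫ x : ℝ, Complex.exp (s * x * Complex.I) * (Real.exp (-x ^ 2 / 2) : ℂ)
          * ((max (H x) 0 : ℝ) : ℂ))
      - ∫ x : ℝ, Complex.exp (s * x * Complex.I) * (Real.exp (-x ^ 2 / 2) : ℂ)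
          * ((max (-H x) 0 : ℝ) : ℂ) = ∫ t, ψ (s + t) ∂(gaussianReal 0 1) := by
    rw [← integral_sub (hintg s _ (by fun_prop) (hmx H hHb))
      (hintg s _ (by fun_prop) (hmx (fun x => -H x) (fun x => by rw [abs_neg]; exact hHb x))),
      ← integral_cexp_mul_gaussian_weight_fourierInvReal hψ]
    refine integral_congr_ae (Eventually.of_forall fun x => ?_)
    simp only
    rw [← mul_sub, ← Complex.ofReal_sub, ← ofReal_re_fourierInvReal hsymm x]
    congr 2
    exact max_zero_sub_max_neg_zero_eq_self (H x)
  have hc : ∀ (κ : Measure ℝ) [IsFiniteMeasure κ],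
      Integrable (fun t => charFun κ (s + t)) (gaussianReal 0 1) := by
    intro κ _
    refine (integrable_const (κ.real univ)).mono' ?_ (Eventually.of_forall fun t => norm_charFun_le _)
    exact (measurable_charFun.comp (measurable_const_add s)).aestronglyMeasurable
  have h4 : ∫ t, ψ (s + t) ∂(gaussianReal 0 1) = ∫ t, charFun ν (s + t) ∂(gaussianReal 0 1)
      - ∫ t, charFun ρ (s + t) ∂(gaussianReal 0 1) := by
    rw [← integral_sub (hc ν) (hc ρ), hψ']
  rw [h4] at h3
  linear_combination -h3

/-- If `ν + a dx = c δ_z + b dx`, then `ν = c δ_z + (b - a)⁺ dx`. -/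
lemma eq_dirac_add_withDensity {ν : Measure ℝ} [IsFiniteMeasure ν] {z : ℝ} {c : ENNReal}
    {a b : ℝ → ℝ} (ha : Measurable a) (hb : Measurable b) (ha0 : ∀ x, 0 ≤ a x)
    (h : ν + volume.withDensity (fun x => ENNReal.ofReal (a x))
      = c • Measure.dirac z + volume.withDensity (fun x => ENNReal.ofReal (b x))) :
    ν {z} = c ∧ ν = c • Measure.dirac z
      + volume.withDensity (fun x => ENNReal.ofReal (b x - a x)) := by
  have hz : ∀ f : ℝ → ENNReal, volume.withDensity f {z} = 0 := fun f =>
    withDensity_absolutelyContinuous _ _ (by simp)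
  have h1 : ν {z} = c := by
    have := congrArg (fun m : Measure ℝ => m {z}) h
    simpa [hz] using this
  refine ⟨h1, ?_⟩
  have h2 : ν.restrict {z}ᶜ + volume.withDensity (fun x => ENNReal.ofReal (a x))
      = volume.withDensity (fun x => ENNReal.ofReal (b x)) := by
    have := congrArg (fun m : Measure ℝ => m.restrict {z}ᶜ) h
    have hr : ∀ f : ℝ → ENNReal,
        (volume.withDensity f).restrict {z}ᶜ = volume.withDensity f := fun f =>
      Measure.restrict_eq_self_of_ae_mem (measure_eq_zero_iff_ae_notMem.1 (hz f))
    have hd : (Measure.dirac z).restrict {z}ᶜ = 0 := Measure.restrict_eq_zero.2 (by simp)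
    simpa [Measure.restrict_add, hr, hd] using this
  have h3 : ν.restrict {z}ᶜ ≪ volume := by
    have : ν.restrict {z}ᶜ ≤ volume.withDensity (fun x => ENNReal.ofReal (b x)) := by
      rw [← h2]; exact Measure.le_add_right le_rfl
    exact (Measure.absolutelyContinuous_of_le this).trans (withDensity_absolutelyContinuous _ _)
  -- Off `z` the measure `ν` is dominated by `b dx`, hence has a density `r`. Uniqueness of
  -- densities turns `r + a = b` into `r = (b - a)⁺` almost everywhere.
  set r := (ν.restrict {z}ᶜ).rnDeriv volume with hr
  have h4 : volume.withDensity r = ν.restrict {z}ᶜ := Measure.withDensity_rnDeriv_eq _ _ h3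
  have hrm : Measurable r := Measure.measurable_rnDeriv _ _
  rw [← h4, ← withDensity_add_left hrm] at h2
  have h5 := (withDensity_eq_iff_of_sigmaFinite (by fun_prop) (by fun_prop)).1 h2
  have h6 : r =ᵐ[volume] fun x => ENNReal.ofReal (b x - a x) := by
    filter_upwards [h5] with x hx
    simp only [Pi.add_apply] at hx
    rw [ENNReal.ofReal_sub _ (ha0 x), ← hx, ENNReal.add_sub_cancel_right ENNReal.ofReal_ne_top]
  rw [← withDensity_congr_ae h6, h4, ← h1, ← Measure.restrict_singleton]
  exact (Measure.restrict_add_restrict_compl (measurableSet_singleton z)).symm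

/-! ### A Parseval bound for measures with bounded density. -/

/-- `|charFun μ|²` is the Fourier transform of `μ ⊗ μ` under `(x, y) ↦ x - y`. By Fubini, averaging
the frequency over a Gaussian produces a Gaussian kernel in `x - y`. -/
lemma integral_normSq_charFun_gaussianReal {μ : Measure ℝ} [IsFiniteMeasure μ] (v : NNReal) :
    ∫ t, ‖charFun μ t‖ ^ 2 ∂(gaussianReal 0 v)
      = ∫ x, ∫ y, Real.exp (-v * (x - y) ^ 2 / 2) ∂μ ∂μ := by
  have hI : ∀ w : ℝ × ℝ × ℝ, ‖Complex.exp ((w.1 * (w.2.1 - w.2.2) : ℝ) * Complex.I)‖ ≤ 1 :=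
    fun w => by rw [Complex.norm_exp_ofReal_mul_I]
  have h1 : ∀ t : ℝ, ((‖charFun μ t‖ ^ 2 : ℝ) : ℂ)
      = ∫ p : ℝ × ℝ, Complex.exp ((t * (p.1 - p.2) : ℝ) * Complex.I) ∂(μ.prod μ) := by
    intro t
    rw [Complex.ofReal_pow, ← Complex.mul_conj', ← charFun_neg, charFun_apply_real,
      charFun_apply_real, ← integral_prod_mul]
    refine integral_congr_ae (Eventually.of_forall fun p => ?_)
    simp only
    rw [← Complex.exp_add]
    congr 1
    push_cast
    ring
  have h2 : ((∫ t, ‖charFun μ t‖ ^ 2 ∂(gaussianReal 0 v) : ℝ) : ℂ)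
      = ((∫ p : ℝ × ℝ, Real.exp (-v * (p.1 - p.2) ^ 2 / 2) ∂(μ.prod μ) : ℝ) : ℂ) := by
    rw [← integral_complex_ofReal, ← integral_complex_ofReal]
    simp_rw [h1]
    rw [integral_integral_swap]
    · refine integral_congr_ae (Eventually.of_forall fun p => ?_)
      have h3 := charFun_gaussianReal (μ := 0) (v := v) (p.1 - p.2)
      rw [charFun_apply_real] at h3
      simp only
      calc _ = ∫ x : ℝ, Complex.exp ((p.1 - p.2 : ℝ) * x * Complex.I) ∂(gaussianReal 0 v) := by
            refine integral_congr_ae (Eventually.of_forall fun x => ?_)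
            simp only
            congr 1
            push_cast
            ring
        _ = _ := by
            rw [h3]
            push_cast
            congr 1
            simp
            ring
    · exact Integrable.mono' (integrable_const (1 : ℝ))
        (Continuous.aestronglyMeasurable (by fun_prop))
        (Eventually.of_forall fun w => hI (w.1, w.2))
  rw [Complex.ofReal_inj.1 h2, integral_prod]
  refine (integrable_const (1 : ℝ)).mono' (Continuous.aestronglyMeasurable (by fun_prop))
    (Eventually.of_forall fun p => ?_)
  rw [Real.norm_of_nonneg (by positivity)]
  refine Real.exp_le_one_iff.2 ?_
  have : 0 ≤ (v : ℝ) * (p.1 - p.2) ^ 2 := by positivity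
  linarith

/-- For fixed `x` the kernel integrates against `μ` to at most `B` times its Lebesgue integral. The
remaining integration over `x` costs the mass of `μ`. -/
lemma integral_normSq_charFun_gaussianReal_le {μ : Measure ℝ} [IsFiniteMeasure μ] {B : NNReal}
    (hB : μ ≤ B • (volume : Measure ℝ)) {v : NNReal} (hv : v ≠ 0) :
    ∫ t, ‖charFun μ t‖ ^ 2 ∂(gaussianReal 0 v)
      ≤ B * Real.sqrt (2 * Real.pi / v) * μ.real univ := by
  rw [integral_normSq_charFun_gaussianReal]
  have hv' : (0 : ℝ) < v := by positivity
  have hb : ∀ x : ℝ, (fun y => Real.exp (-v * (x - y) ^ 2 / 2))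
      = fun y => Real.exp (-(v / 2 : ℝ) * (y - x) ^ 2) := fun x => funext fun y => by
    congr 1; ring
  have h0 := integrable_exp_neg_mul_sq (b := (v / 2 : ℝ)) (by positivity)
  have hi : ∀ x : ℝ, Integrable (fun y => Real.exp (-v * (x - y) ^ 2 / 2)) := fun x => by
    rw [hb]
    exact h0.comp_sub_right x
  have hin : ∀ x : ℝ, ∫ y, Real.exp (-v * (x - y) ^ 2 / 2) ∂μ
      ≤ B * Real.sqrt (2 * Real.pi / v) := by
    intro x
    calc _ ≤ ∫ y, Real.exp (-v * (x - y) ^ 2 / 2) ∂(B • (volume : Measure ℝ)) :=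
          integral_mono_measure hB (Eventually.of_forall fun y => by positivity)
            ((hi x).smul_measure_nnreal)
      _ = _ := by
          rw [integral_smul_nnreal_measure, hb,
            integral_sub_right_eq_self (fun y => Real.exp (-(v / 2 : ℝ) * y ^ 2)) x,
            integral_gaussian, NNReal.smul_def, smul_eq_mul]
          congr 2
          field_simp
  calc _ ≤ ∫ x, B * Real.sqrt (2 * Real.pi / v) ∂μ :=
        integral_mono_of_nonneg (Eventually.of_forall fun x => integral_nonneg fun y => by positivity)
          (integrable_const _) (Eventually.of_forall hin)
    _ = _ := by rw [integral_const, smul_eq_mul, mul_comm]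

/-- A measure with bounded density has a square-integrable characteristic function. -/
theorem lintegral_normSq_charFun_le {μ : Measure ℝ} [IsFiniteMeasure μ] {B : NNReal}
    (hB : μ ≤ B • (volume : Measure ℝ)) :
    ∫⁻ t, ENNReal.ofReal (‖charFun μ t‖ ^ 2)
      ≤ ENNReal.ofReal (2 * Real.pi * B * μ.real univ) := by
  have hc : Measurable fun t => ‖charFun μ t‖ ^ 2 := by
    have := measurable_charFun (μ := μ)
    fun_prop
  -- Gaussian damping of variance `n + 1`, removed by Fatou as `n → ∞`.
  set F : ℕ → ℝ → ENNReal := fun n t =>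
    ENNReal.ofReal (‖charFun μ t‖ ^ 2 * Real.exp (-t ^ 2 / (2 * (n + 1)))) with hF
  have hlim : ∀ t, Tendsto (fun n => F n t) atTop (𝓝 (ENNReal.ofReal (‖charFun μ t‖ ^ 2))) := by
    intro t
    refine ENNReal.tendsto_ofReal ?_
    have h1 : Tendsto (fun n : ℕ => -t ^ 2 / (2 * ((n : ℝ) + 1))) atTop (𝓝 0) := by
      refine Tendsto.const_div_atTop ?_ _
      exact Tendsto.const_mul_atTop two_pos
        (tendsto_natCast_atTop_atTop.atTop_add tendsto_const_nhds)
    simpa using (Real.continuous_exp.tendsto 0).comp h1 |>.const_mul (‖charFun μ t‖ ^ 2)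
  have hle : ∀ n, ∫⁻ t, F n t ≤ ENNReal.ofReal (2 * Real.pi * B * μ.real univ) := by
    intro n
    set v : NNReal := n + 1 with hv
    have hv0 : v ≠ 0 := by positivity
    have hvr : ((v : NNReal) : ℝ) = n + 1 := by simp [hv]
    have hvp : (0 : ℝ) < n + 1 := by positivity
    have h1 := integral_normSq_charFun_gaussianReal_le hB hv0
    rw [integral_gaussianReal_eq_integral_smul hv0] at h1
    have hintg : Integrable (fun t => ‖charFun μ t‖ ^ 2 * Real.exp (-t ^ 2 / (2 * (n + 1)))) := by
      have h0 := (integrable_exp_neg_mul_sq (b := (2 * ((n : ℝ) + 1))⁻¹) (by positivity)).const_mul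
        (μ.real univ ^ 2)
      refine h0.mono' (by fun_prop) (Eventually.of_forall fun t => ?_)
      rw [Real.norm_of_nonneg (by positivity)]
      have e : -t ^ 2 / (2 * ((n : ℝ) + 1)) = -(2 * ((n : ℝ) + 1))⁻¹ * t ^ 2 := by
        field_simp
      rw [e]
      gcongr
      exact norm_charFun_le t
    rw [← ofReal_integral_eq_lintegral_ofReal hintg (Eventually.of_forall fun t => by positivity)]
    refine ENNReal.ofReal_le_ofReal ?_
    have e : ∀ t, gaussianPDFReal 0 v t • ‖charFun μ t‖ ^ 2
        = (Real.sqrt (2 * Real.pi * (n + 1)))⁻¹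
          * (‖charFun μ t‖ ^ 2 * Real.exp (-t ^ 2 / (2 * (n + 1)))) := by
      intro t
      rw [gaussianPDFReal, smul_eq_mul, hvr, sub_zero]
      ring
    simp_rw [e] at h1
    rw [integral_const_mul, hvr, inv_mul_le_iff₀ (by positivity)] at h1
    refine h1.trans (le_of_eq ?_)
    -- The normalization of the Gaussian density cancels the width of the kernel, so the bound does
    -- not depend on `n`.
    have e2 : Real.sqrt (2 * Real.pi * (n + 1)) * Real.sqrt (2 * Real.pi / (n + 1))
        = 2 * Real.pi := by
      rw [← Real.sqrt_mul (by positivity), show 2 * Real.pi * ((n : ℝ) + 1)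
        * (2 * Real.pi / (n + 1)) = (2 * Real.pi) ^ 2 by field_simp, Real.sqrt_sq (by positivity)]
    linear_combination (B * μ.real univ) * e2
  calc _ = ∫⁻ t, liminf (fun n => F n t) atTop :=
        lintegral_congr fun t => ((hlim t).liminf_eq).symm
    _ ≤ liminf (fun n => ∫⁻ t, F n t) atTop := lintegral_liminf_le fun n => by
        simp only [hF]; fun_prop
    _ ≤ _ := by
        refine (liminf_le_liminf (Eventually.of_forall hle)).trans (le_of_eq ?_)
        simp

theorem integrable_normSq_charFun {μ : Measure ℝ} [IsFiniteMeasure μ] {B : NNReal}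
    (hB : μ ≤ B • (volume : Measure ℝ)) : Integrable fun t => ‖charFun μ t‖ ^ 2 := by
  refine ⟨?_, ?_⟩
  · have := measurable_charFun (μ := μ)
    exact Measurable.aestronglyMeasurable (by fun_prop)
  · rw [hasFiniteIntegral_iff_ofReal (Eventually.of_forall fun t => by positivity)]
    exact (lintegral_normSq_charFun_le hB).trans_lt ENNReal.ofReal_lt_top

theorem integral_normSq_charFun_le {μ : Measure ℝ} [IsFiniteMeasure μ] {B : NNReal}
    (hB : μ ≤ B • (volume : Measure ℝ)) :
    ∫ t, ‖charFun μ t‖ ^ 2 ≤ 2 * Real.pi * B * μ.real univ := by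
  rw [integral_eq_lintegral_of_nonneg_ae (Eventually.of_forall fun t => by positivity)
    (integrable_normSq_charFun hB).aestronglyMeasurable]
  exact ENNReal.toReal_le_of_le_ofReal (by positivity) (lintegral_normSq_charFun_le hB)

/-! ### Compound Poisson laws: atom, single jump, several jumps. -/

lemma norm_cexp_sub_cexp_le {z w : ℂ} {M : ℝ} (hz : z.re ≤ M) (hw : w.re ≤ M) :
    ‖Complex.exp z - Complex.exp w‖ ≤ Real.exp M * ‖z - w‖ := by
  refine (convex_halfSpace_re_le M).norm_image_sub_le_of_norm_hasDerivWithin_le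
    (f := Complex.exp) (f' := Complex.exp)
    (fun x _ => (Complex.hasDerivAt_exp x).hasDerivWithinAt) (fun x hx => ?_) hw hz
  rw [Complex.norm_exp]
  exact Real.exp_le_exp.2 hx

/-- The mean value inequality along the segment from `w` to `z`, applied to `u ↦ exp u - u exp w`.
Its derivative `exp u - exp w` is controlled by the first-order bound. -/
lemma norm_cexp_sub_cexp_sub_mul_le {z w : ℂ} {M : ℝ} (hz : z.re ≤ M) (hw : w.re ≤ M) :
    ‖Complex.exp z - Complex.exp w - (z - w) * Complex.exp w‖ ≤ Real.exp M * ‖z - w‖ ^ 2 := by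
  have hd : ∀ x ∈ segment ℝ w z, HasDerivWithinAt (fun u => Complex.exp u - u * Complex.exp w)
      (Complex.exp x - Complex.exp w) (segment ℝ w z) x := fun x _ =>
    ((Complex.hasDerivAt_exp x).sub
      (by simpa using (hasDerivAt_id x).mul_const (Complex.exp w))).hasDerivWithinAt
  have hsub : segment ℝ w z ⊆ {u : ℂ | u.re ≤ M} :=
    (convex_halfSpace_re_le M).segment_subset hw hz
  have h := (convex_segment w z).norm_image_sub_le_of_norm_hasDerivWithin_le hd
    (C := Real.exp M * ‖z - w‖) (fun x hx => ?_) (left_mem_segment ℝ w z) (right_mem_segment ℝ w z)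
  · calc _ = ‖Complex.exp z - z * Complex.exp w - (Complex.exp w - w * Complex.exp w)‖ := by
          congr 1; ring
      _ ≤ _ := h
      _ = _ := by ring
  · refine (norm_cexp_sub_cexp_le (hsub hx) hw).trans ?_
    gcongr
    obtain ⟨a, b, ha, hb, hab, rfl⟩ := hx
    have : a • w + b • z - w = b • (z - w) := by
      rw [eq_sub_of_add_eq hab]
      module
    rw [this, norm_smul, Real.norm_of_nonneg hb]
    exact mul_le_of_le_one_left (norm_nonneg _) (by linarith)

lemma norm_cexp_sub_one_sub_le {z : ℂ} {M : ℝ} (hz : z.re ≤ M) (hM : 0 ≤ M) :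
    ‖Complex.exp z - 1 - z‖ ≤ Real.exp M * ‖z‖ ^ 2 := by
  simpa using norm_cexp_sub_cexp_sub_mul_le (w := 0) hz (by simpa using hM)

/-- The characteristic function of the part with at least two jumps of the compound Poisson law
with jump measure `μ`. -/
noncomputable def multiJumpCharFun (μ : Measure ℝ) (t : ℝ) : ℂ :=
  Real.exp (-μ.real univ) * (Complex.exp (charFun μ t) - 1 - charFun μ t)

lemma re_charFun_le {μ : Measure ℝ} (t : ℝ) : (charFun μ t).re ≤ μ.real univ :=
  (Complex.re_le_norm _).trans (norm_charFun_le t)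

/-- Removing `1 + φ` makes the remainder quadratic in `φ`, hence integrable by the Parseval bound. A
gap `D` between `Re φ` and the total mass becomes a gain `e^{-D}`; the case `D = 0` is always
available. -/
lemma norm_multiJumpCharFun_le {μ : Measure ℝ} {t D : ℝ} (hD : D ≤ μ.real univ)
    (h : (charFun μ t).re ≤ μ.real univ - D) :
    ‖multiJumpCharFun μ t‖ ≤ Real.exp (-D) * ‖charFun μ t‖ ^ 2 := by
  unfold multiJumpCharFun
  rw [norm_mul, Complex.norm_real, Real.norm_of_nonneg (by positivity)]
  calc _ ≤ Real.exp (-μ.real univ) * (Real.exp (μ.real univ - D) * ‖charFun μ t‖ ^ 2) := by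
        gcongr
        exact norm_cexp_sub_one_sub_le h (by linarith)
    _ = _ := by
        rw [← mul_assoc, ← Real.exp_add]
        congr 2
        ring

lemma integrable_multiJumpCharFun {μ : Measure ℝ} [IsFiniteMeasure μ] {B : NNReal}
    (hB : μ ≤ B • (volume : Measure ℝ)) : Integrable (multiJumpCharFun μ) := by
  refine (integrable_normSq_charFun hB).mono' ?_ (Eventually.of_forall fun t => ?_)
  · have := measurable_charFun (μ := μ)
    unfold multiJumpCharFun
    exact Measurable.aestronglyMeasurable (by fun_prop)
  · simpa using norm_multiJumpCharFun_le (D := 0) measureReal_nonneg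
      (by simpa using re_charFun_le (μ := μ) t)

/-- The density of the absolutely continuous part of the compound Poisson law with jump measure
`G(x) dx`. -/
noncomputable def compoundPoissonDensity (G : ℝ → ℝ) (x : ℝ) : ℝ :=
  let μ := volume.withDensity fun x => ENNReal.ofReal (G x)
  Real.exp (-μ.real univ) * G x + (fourierInvReal (multiJumpCharFun μ) x).re

/-- `ν` and `e^{-λ}(δ₀ + μ)` have characteristic functions differing by the integrable
`multiJumpCharFun μ`, so inversion applies to the difference alone. Nonnegativity of
`compoundPoissonDensity` is not established pointwise; `ENNReal.ofReal` truncates it. -/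
theorem compoundPoisson_eq {ν μ : Measure ℝ} [IsFiniteMeasure ν] [IsFiniteMeasure μ] {G : ℝ → ℝ}
    {B : NNReal} (hGm : Measurable G) (hG0 : ∀ x, 0 ≤ G x)
    (hμ : μ = volume.withDensity fun x => ENNReal.ofReal (G x))
    (hB : μ ≤ B • (volume : Measure ℝ))
    (hν : ∀ t, charFun ν t = Complex.exp (charFun μ t - μ.real univ)) :
    ν {0} = ENNReal.ofReal (Real.exp (-μ.real univ)) ∧
    ν = ν {0} • Measure.dirac 0
      + volume.withDensity fun x => ENNReal.ofReal (compoundPoissonDensity G x) := by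
  set c := Real.exp (-μ.real univ) with hc
  have hc0 : 0 ≤ c := by positivity
  have hψ := integrable_multiJumpCharFun hB
  set H : ℝ → ℝ := fun x => (fourierInvReal (multiJumpCharFun μ) x).re with hH
  have hHm : Measurable H := (Complex.continuous_re.comp (continuous_fourierInvReal hψ)).measurable
  have hfin : IsFiniteMeasure (ENNReal.ofReal c • (Measure.dirac 0 + μ)) :=
    Measure.smul_finite _ ENNReal.ofReal_ne_top
  have hchar : ∀ t, charFun ν t
      = charFun (ENNReal.ofReal c • (Measure.dirac 0 + μ)) t + multiJumpCharFun μ t := by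
    intro t
    have hi : ∀ (κ : Measure ℝ) [IsFiniteMeasure κ],
        Integrable (fun x : ℝ => Complex.exp (t * x * Complex.I)) κ := by
      intro κ _
      refine (integrable_const (1 : ℝ)).mono' (Continuous.aestronglyMeasurable (by fun_prop))
        (Eventually.of_forall fun x => ?_)
      rw [← Complex.ofReal_mul, Complex.norm_exp_ofReal_mul_I]
    rw [hν, charFun_apply_real (μ := ENNReal.ofReal c • (Measure.dirac 0 + μ)),
      integral_smul_measure, integral_add_measure (hi _) (hi _), ← charFun_apply_real,
      ← charFun_apply_real, ENNReal.toReal_ofReal hc0, Complex.real_smul, multiJumpCharFun,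
      sub_eq_add_neg, Complex.exp_add, hc]
    simp
    ring
  have key := add_withDensity_fourierInvReal hψ hchar
  have e1 : ∀ f : ℝ → ℝ, (fun x => ENNReal.ofReal (f x)) = fun x => ENNReal.ofReal (max (f x) 0) :=
    fun f => funext fun x => by simp
  have e2 : volume.withDensity (fun x => ENNReal.ofReal (max (-H x) 0))
      = volume.withDensity fun x => ENNReal.ofReal (-H x) := by rw [← e1 fun x => -H x]
  have e3 : ENNReal.ofReal c • μ + volume.withDensity (fun x => ENNReal.ofReal (H x))
      = volume.withDensity (fun x => ENNReal.ofReal (c * G x + max (H x) 0)) := by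
    rw [hμ, ← withDensity_smul _ (by fun_prop), ← withDensity_add_left (by fun_prop)]
    congr 1
    funext x
    simp only [Pi.add_apply, Pi.smul_apply, smul_eq_mul]
    rw [ENNReal.ofReal_add (mul_nonneg hc0 (hG0 x)) (le_max_right _ _), ENNReal.ofReal_mul hc0]
    congr 1
    exact congrFun (e1 H) x
  rw [smul_add, add_assoc, e3, ← e2] at key
  -- With `a = H⁻` and `b = cG + H⁺`, the difference `b - a` is `cG + H`.
  have hfinal := eq_dirac_add_withDensity (a := fun x => max (-H x) 0)
    (b := fun x => c * G x + max (H x) 0) (by fun_prop) (by fun_prop)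
    (fun x => le_max_right _ _) key
  refine ⟨hfinal.1, ?_⟩
  rw [hfinal.1]
  refine hfinal.2.trans ?_
  congr 2
  funext x
  congr 1
  simp only [compoundPoissonDensity]
  rw [← hμ, ← hc, add_sub_assoc]
  congr 1
  exact max_zero_sub_max_neg_zero_eq_self (H x)

/-! ### Exponential tilting and its effect on the jump measure. -/

section MGF
variable {ν κ : Measure ℝ}

/-- `mgf` has the default value 0 where the exponential is not integrable, so positivity forces
integrability. -/
lemma integrableExpSet_eq_univ_of_mgf {c : ℝ → ℝ} (h : ∀ θ, mgf id ν θ = Real.exp (c θ)) :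
    integrableExpSet id ν = univ := by
  refine eq_univ_of_forall fun θ => ?_
  by_contra hθ
  have h1 := mgf_undef (X := id) (μ := ν) hθ
  rw [h θ] at h1
  exact (Real.exp_pos _).ne' h1

/-- Exponential formula on the real line extends to the complex plane. -/
lemma complexMGF_eq_cexp_of_mgf (hκ : integrableExpSet id κ = univ)
    (h : ∀ θ, mgf id ν θ = Real.exp (mgf id κ θ - κ.real univ)) (z : ℂ) :
    complexMGF id ν z = Complex.exp (complexMGF id κ z - κ.real univ) := by
  have hν := integrableExpSet_eq_univ_of_mgf h
  have h1 : AnalyticOnNhd ℂ (complexMGF id ν) univ := by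
    simpa [hν] using analyticOnNhd_complexMGF (X := id) (μ := ν)
  have h2 : AnalyticOnNhd ℂ (complexMGF id κ) univ := by
    simpa [hκ] using analyticOnNhd_complexMGF (X := id) (μ := κ)
  have h3 : AnalyticOnNhd ℂ (fun z => Complex.exp (complexMGF id κ z - κ.real univ)) univ :=
    (h2.sub analyticOnNhd_const).cexp
  have hreal : ∀ x : ℝ, complexMGF id ν x = Complex.exp (complexMGF id κ x - κ.real univ) := by
    intro x
    rw [complexMGF_ofReal, complexMGF_ofReal, h]
    push_cast
    rfl
  -- Identity theorem: two entire functions agree on the real axis, which accumulates at 0.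
  refine h1.eqOn_of_preconnected_of_frequently_eq h3 isPreconnected_univ (mem_univ 0) ?_
    (mem_univ z)
  have hf : ∃ᶠ x : ℝ in 𝓝[≠] 0, complexMGF id ν x
      = Complex.exp (complexMGF id κ x - κ.real univ) := (Eventually.of_forall hreal).frequently
  have ht : Tendsto (fun x : ℝ => (x : ℂ)) (𝓝[≠] 0) (𝓝[≠] 0) := by
    refine tendsto_nhdsWithin_of_tendsto_nhds_of_eventually_within _ ?_ ?_
    · simpa using (Complex.continuous_ofReal.tendsto 0).mono_left nhdsWithin_le_nhds
    · filter_upwards [self_mem_nhdsWithin] with x hx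
      simpa using hx
  exact ht.frequently hf

lemma charFun_exp_withDensity (β t : ℝ) :
    charFun (κ.withDensity fun x => ENNReal.ofReal (Real.exp (β * x))) t
      = complexMGF id κ (β + t * Complex.I) := by
  rw [charFun_withDensity (by fun_prop) (fun x => by positivity), complexMGF]
  refine integral_congr_ae (Eventually.of_forall fun x => ?_)
  simp only [id]
  push_cast
  rw [← Complex.exp_add]
  congr 1
  ring

lemma real_univ_exp_withDensity (β : ℝ) :
    (κ.withDensity fun x => ENNReal.ofReal (Real.exp (β * x))).real univ = mgf id κ β := by
  have h := charFun_zero (κ.withDensity fun x => ENNReal.ofReal (Real.exp (β * x)))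
  rw [charFun_exp_withDensity] at h
  simp only [Complex.ofReal_zero, zero_mul, add_zero, complexMGF_ofReal] at h
  exact_mod_cast h.symm

/-- Tilting shifts the argument of `complexMGF` by `β`. In the exponent the same shift multiplies
the jump measure by `exp(βx)`, and dividing by `mgf id ν β` supplies the new total mass. -/
lemma charFun_cramerTilt (hκ : integrableExpSet id κ = univ)
    (h : ∀ θ, mgf id ν θ = Real.exp (mgf id κ θ - κ.real univ)) (β t : ℝ) :
    charFun (cramerTilt ν β) t = Complex.exp
      (charFun (κ.withDensity fun x => ENNReal.ofReal (Real.exp (β * x))) t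
        - (κ.withDensity fun x => ENNReal.ofReal (Real.exp (β * x))).real univ) := by
  rw [charFun_exp_withDensity, real_univ_exp_withDensity, charFun_apply_real, cramerTilt]
  change ∫ x : ℝ, Complex.exp (t * x * Complex.I) ∂(ν.tilted (fun x => β * id x)) = _
  rw [integral_tilted_mul_eq_mgf (X := id)]
  have e : ∀ x : ℝ, (Real.exp (β * id x) / mgf id ν β) • Complex.exp (t * x * Complex.I)
      = (mgf id ν β : ℂ)⁻¹ * Complex.exp ((β + t * Complex.I) * (id x : ℝ)) := by
    intro x
    rw [Complex.real_smul, add_mul, Complex.exp_add]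
    push_cast
    simp only [id]
    rw [show (t : ℂ) * x * Complex.I = t * Complex.I * x by ring]
    ring
  simp_rw [e]
  rw [integral_const_mul]
  change _ * complexMGF id ν _ = _
  rw [complexMGF_eq_cexp_of_mgf hκ h, h, Complex.ofReal_exp, ← Complex.exp_neg, ← Complex.exp_add]
  congr 1
  push_cast
  ring

lemma cgf_eq_of_mgf (h : ∀ θ, mgf id ν θ = Real.exp (mgf id κ θ - κ.real univ)) :
    cgf id ν = fun θ => mgf id κ θ - κ.real univ := by
  funext θ
  rw [cgf, h, Real.log_exp]

lemma integral_pow_exp_withDensity (β : ℝ) (n : ℕ) :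
    ∫ x, x ^ n ∂(κ.withDensity fun x => ENNReal.ofReal (Real.exp (β * x)))
      = ∫ x, x ^ n * Real.exp (β * x) ∂κ := by
  rw [integral_withDensity_eq_integral_toReal_smul (by fun_prop)
    (Eventually.of_forall fun x => by simp)]
  refine integral_congr_ae (Eventually.of_forall fun x => ?_)
  simp only
  rw [ENNReal.toReal_ofReal (by positivity), smul_eq_mul, mul_comm]

/-- The mean of the tilt is the derivative of the cumulant generating function, which here is `mgf
id κ` up to a constant. -/
lemma tiltMean_eq (hκ : integrableExpSet id κ = univ)
    (h : ∀ θ, mgf id ν θ = Real.exp (mgf id κ θ - κ.real univ)) (β : ℝ) :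
    tiltMean ν β = ∫ x, x ∂(κ.withDensity fun x => ENNReal.ofReal (Real.exp (β * x))) := by
  have hν := integrableExpSet_eq_univ_of_mgf h
  have h1 := integral_tilted_mul_self (X := id) (μ := ν) (t := β) (by simp [hν])
  rw [cgf_eq_of_mgf h, deriv_sub_const, deriv_mgf (by simp [hκ])] at h1
  have h2 := integral_pow_exp_withDensity (κ := κ) β 1
  simp only [pow_one] at h2
  rw [h2]
  exact h1

lemma tiltVariance_eq (hκ : integrableExpSet id κ = univ)
    (h : ∀ θ, mgf id ν θ = Real.exp (mgf id κ θ - κ.real univ)) (β : ℝ) :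
    variance (fun t : ℝ => t) (cramerTilt ν β)
      = ∫ x, x ^ 2 ∂(κ.withDensity fun x => ENNReal.ofReal (Real.exp (β * x))) := by
  have hν := integrableExpSet_eq_univ_of_mgf h
  have h1 := variance_tilted_mul (X := id) (μ := ν) (t := β) (by simp [hν])
  have h3 : iteratedDeriv 2 (fun θ => mgf id κ θ - κ.real univ) β = iteratedDeriv 2 (mgf id κ) β := by
    have hd : deriv (fun θ => mgf id κ θ - κ.real univ) = deriv (mgf id κ) :=
      funext fun θ => deriv_sub_const _
    rw [iteratedDeriv_succ', hd, ← iteratedDeriv_succ']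
  rw [cgf_eq_of_mgf h, h3, iteratedDeriv_mgf (by simp [hκ])] at h1
  rw [integral_pow_exp_withDensity]
  exact h1

end MGF

/-! ### Taylor estimates for jump measures on the unit interval. -/

section UnitInterval
variable {μ : Measure ℝ} [IsFiniteMeasure μ]

lemma integrable_of_ae_mem_Icc {E : Type*} [NormedAddCommGroup E]
    (hμ : ∀ᵐ x ∂μ, x ∈ Icc (0 : ℝ) 1) {f : ℝ → E} (hf : Continuous f) : Integrable f μ := by
  obtain ⟨C, hC⟩ := (isCompact_Icc (a := (0 : ℝ)) (b := 1)).exists_bound_of_continuousOn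
    hf.continuousOn
  refine (integrable_const C).mono' ?_ (hμ.mono fun x hx => hC x hx)
  exact hf.aestronglyMeasurable

lemma re_charFun (t : ℝ) : (charFun μ t).re = ∫ x, Real.cos (t * x) ∂μ := by
  have hi : Integrable (fun x : ℝ => Complex.exp (t * x * Complex.I)) μ := by
    refine (integrable_const (1 : ℝ)).mono' (Continuous.aestronglyMeasurable (by fun_prop))
      (Eventually.of_forall fun x => ?_)
    rw [← Complex.ofReal_mul, Complex.norm_exp_ofReal_mul_I]
  rw [charFun_apply_real]
  change RCLike.re (∫ x : ℝ, Complex.exp (t * x * Complex.I) ∂μ) = _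
  rw [← integral_re hi]
  refine integral_congr_ae (Eventually.of_forall fun x => ?_)
  simp only
  rw [← Complex.ofReal_mul]
  exact Complex.exp_ofReal_mul_I_re _

/-- Taylor's remainder for the exponential is integrated over `x`. Since `x ≤ 1`, the cutoff `|t| ≤
π` gives `|tx| ≤ π` and the uniform factor `e^π`. -/
lemma norm_charFun_sub_sum_le (hμ : ∀ᵐ x ∂μ, x ∈ Icc (0 : ℝ) 1) (n : ℕ) {t : ℝ}
    (ht : |t| ≤ Real.pi) :
    ‖charFun μ t - ∑ m ∈ Finset.range n,
        (t * Complex.I) ^ m / (m.factorial : ℂ) * ((∫ x, x ^ m ∂μ : ℝ) : ℂ)‖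
      ≤ Real.exp Real.pi * |t| ^ n * ∫ x, x ^ n ∂μ := by
  have h1 : charFun μ t - ∑ m ∈ Finset.range n,
        (t * Complex.I) ^ m / (m.factorial : ℂ) * ((∫ x, x ^ m ∂μ : ℝ) : ℂ)
      = ∫ x : ℝ, (Complex.exp (t * x * Complex.I)
        - ∑ m ∈ Finset.range n, (t * x * Complex.I) ^ m / (m.factorial : ℂ)) ∂μ := by
    have hc : ∀ m : ℕ, Continuous fun x : ℝ => (t * x * Complex.I) ^ m / (m.factorial : ℂ) :=
      fun m => by fun_prop
    rw [integral_sub (integrable_of_ae_mem_Icc hμ (by fun_prop))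
      (integrable_of_ae_mem_Icc hμ (continuous_finsetSum _ fun m _ => hc m)),
      integral_finsetSum _ (fun m _ => integrable_of_ae_mem_Icc hμ (hc m)), charFun_apply_real]
    congr 1
    refine Finset.sum_congr rfl fun m _ => ?_
    rw [← integral_complex_ofReal, ← integral_const_mul]
    refine integral_congr_ae (Eventually.of_forall fun x => ?_)
    simp only
    push_cast
    ring
  rw [h1, ← integral_const_mul]
  refine (norm_integral_le_integral_norm _).trans ?_
  refine integral_mono_of_nonneg (Eventually.of_forall fun x => norm_nonneg _)
    (integrable_of_ae_mem_Icc hμ (by fun_prop)) (hμ.mono fun x hx => ?_)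
  refine (Complex.norm_exp_sub_sum_le_norm_mul_exp _ n).trans ?_
  have h2 : ‖(t * x * Complex.I : ℂ)‖ = |t| * x := by
    rw [norm_mul, norm_mul, Complex.norm_I, Complex.norm_real, Complex.norm_real, mul_one,
      Real.norm_eq_abs, Real.norm_of_nonneg hx.1]
  rw [h2, mul_pow]
  have h3 : |t| * x ≤ Real.pi := (mul_le_of_le_one_right (abs_nonneg _) hx.2).trans ht
  have h4 := Real.exp_le_exp.2 h3
  have h5 : 0 ≤ |t| ^ n * x ^ n := mul_nonneg (by positivity) (pow_nonneg hx.1 n)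
  nlinarith

/-- Integrates `cos u ≤ 1 - 2u²/π²`, valid for `|u| ≤ π`. This is why frequencies are cut at `π`. -/
lemma re_charFun_sub_le (hμ : ∀ᵐ x ∂μ, x ∈ Icc (0 : ℝ) 1) {t : ℝ} (ht : |t| ≤ Real.pi) :
    (charFun μ t).re - μ.real univ ≤ -(2 / Real.pi ^ 2) * t ^ 2 * ∫ x, x ^ 2 ∂μ := by
  have h1 : μ.real univ = ∫ _, (1 : ℝ) ∂μ := by simp
  rw [re_charFun, h1, ← integral_sub (integrable_of_ae_mem_Icc hμ (by fun_prop))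
    (integrable_const _), ← integral_const_mul]
  refine integral_mono_ae (integrable_of_ae_mem_Icc hμ (by fun_prop))
    (integrable_of_ae_mem_Icc hμ (by fun_prop)) (hμ.mono fun x hx => ?_)
  have h2 : |t * x| ≤ Real.pi := by
    rw [abs_mul, abs_of_nonneg hx.1]
    exact (mul_le_of_le_one_right (abs_nonneg _) hx.2).trans ht
  have := Real.cos_le_one_sub_mul_cos_sq h2
  simp only
  linarith [mul_pow t x 2, show -(2 / Real.pi ^ 2) * t ^ 2 * x ^ 2
    = -(2 / Real.pi ^ 2 * (t * x) ^ 2) by ring]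

lemma integral_pow_le_integral_pow (hμ : ∀ᵐ x ∂μ, x ∈ Icc (0 : ℝ) 1) {m n : ℕ} (hn : m ≤ n) :
    ∫ x, x ^ n ∂μ ≤ ∫ x, x ^ m ∂μ := by
  refine integral_mono_ae (integrable_of_ae_mem_Icc hμ (by fun_prop))
    (integrable_of_ae_mem_Icc hμ (by fun_prop)) (hμ.mono fun x hx => ?_)
  exact pow_le_pow_of_le_one hx.1 hx.2 hn

/-- Logarithm of the characteristic function of the standardized compound Poisson variable with
jump measure `μ`. -/
noncomputable def stdLogCharFun (μ : Measure ℝ) (σ s : ℝ) : ℂ :=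
  charFun μ (s / σ) - μ.real univ - (s / σ : ℝ) * Complex.I * (∫ x, x ∂μ : ℝ)

lemma re_stdLogCharFun_le (hμ : ∀ᵐ x ∂μ, x ∈ Icc (0 : ℝ) 1) {σ s : ℝ} (hσ : 0 < σ)
    (hσ2 : σ ^ 2 = ∫ x, x ^ 2 ∂μ) (hs : |s| ≤ Real.pi * σ) :
    (stdLogCharFun μ σ s).re ≤ -(2 / Real.pi ^ 2) * s ^ 2 := by
  have ht : |s / σ| ≤ Real.pi := by
    rw [abs_div, abs_of_pos hσ, div_le_iff₀ hσ]
    exact hs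
  have h := re_charFun_sub_le hμ ht
  rw [← hσ2] at h
  have e : (stdLogCharFun μ σ s).re = (charFun μ (s / σ)).re - μ.real univ := by
    simp [stdLogCharFun]
  rw [e]
  refine h.trans (le_of_eq ?_)
  field_simp

lemma norm_stdLogCharFun_add_le (hμ : ∀ᵐ x ∂μ, x ∈ Icc (0 : ℝ) 1) {σ s : ℝ} (hσ : 0 < σ)
    (hσ2 : σ ^ 2 = ∫ x, x ^ 2 ∂μ) (hs : |s| ≤ Real.pi * σ) :
    ‖stdLogCharFun μ σ s - (-s ^ 2 / 2 : ℝ)‖ ≤ Real.exp Real.pi * |s| ^ 3 / σ := by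
  have ht : |s / σ| ≤ Real.pi := by
    rw [abs_div, abs_of_pos hσ, div_le_iff₀ hσ]
    exact hs
  have h := norm_charFun_sub_sum_le hμ 3 ht
  have e : stdLogCharFun μ σ s - (-s ^ 2 / 2 : ℝ) = charFun μ (s / σ) - ∑ m ∈ Finset.range 3,
        ((s / σ : ℝ) * Complex.I) ^ m / (m.factorial : ℂ) * ((∫ x, x ^ m ∂μ : ℝ) : ℂ) := by
    rw [stdLogCharFun, Finset.sum_range_succ, Finset.sum_range_succ, Finset.sum_range_one, ← hσ2]
    have : (σ : ℂ) ≠ 0 := by exact_mod_cast hσ.ne'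
    simp [Nat.factorial, mul_pow]
    field_simp
    ring
  rw [e]
  refine h.trans ?_
  -- `x³ ≤ x²` on `[0,1]`, so the third moment is at most `σ²` and only one factor `1/σ` of `1/σ³`
  -- survives.
  have h3 := integral_pow_le_integral_pow hμ (m := 2) (n := 3) (by norm_num)
  rw [← hσ2] at h3
  calc _ ≤ Real.exp Real.pi * |s / σ| ^ 3 * σ ^ 2 := by gcongr
    _ = _ := by
      rw [abs_div, abs_of_pos hσ]
      field_simp

/-- The cubic term is kept explicit because its oddness is exploited at `y = 0`; what remains has
order `1/σ²`. -/
lemma norm_stdLogCharFun_add_sub_le (hμ : ∀ᵐ x ∂μ, x ∈ Icc (0 : ℝ) 1) {σ s : ℝ} (hσ : 0 < σ)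
    (hσ2 : σ ^ 2 = ∫ x, x ^ 2 ∂μ) (hs : |s| ≤ Real.pi * σ) :
    ‖stdLogCharFun μ σ s - (-s ^ 2 / 2 : ℝ)
        - (-(∫ x, x ^ 3 ∂μ) / (6 * σ ^ 3) : ℝ) * Complex.I * (s ^ 3 : ℝ)‖
      ≤ Real.exp Real.pi * s ^ 4 / σ ^ 2 := by
  have ht : |s / σ| ≤ Real.pi := by
    rw [abs_div, abs_of_pos hσ, div_le_iff₀ hσ]
    exact hs
  have h := norm_charFun_sub_sum_le hμ 4 ht
  have e : stdLogCharFun μ σ s - (-s ^ 2 / 2 : ℝ)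
        - (-(∫ x, x ^ 3 ∂μ) / (6 * σ ^ 3) : ℝ) * Complex.I * (s ^ 3 : ℝ)
      = charFun μ (s / σ) - ∑ m ∈ Finset.range 4,
        ((s / σ : ℝ) * Complex.I) ^ m / (m.factorial : ℂ) * ((∫ x, x ^ m ∂μ : ℝ) : ℂ) := by
    rw [stdLogCharFun, Finset.sum_range_succ, Finset.sum_range_succ, Finset.sum_range_succ,
      Finset.sum_range_one, ← hσ2]
    have : (σ : ℂ) ≠ 0 := by exact_mod_cast hσ.ne'
    have hI : Complex.I ^ 3 = -Complex.I := Complex.I_pow_three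
    simp [Nat.factorial, mul_pow, hI]
    field_simp
    ring
  rw [e]
  refine h.trans ?_
  have h3 := integral_pow_le_integral_pow hμ (m := 2) (n := 4) (by norm_num)
  rw [← hσ2] at h3
  calc _ ≤ Real.exp Real.pi * |s / σ| ^ 4 * σ ^ 2 := by gcongr
    _ = _ := by
      rw [abs_div, abs_of_pos hσ, div_pow, Even.pow_abs (by decide)]
      field_simp

end UnitInterval

/-! ### Comparison with the Gaussian on the Fourier side. -/

lemma integrable_pow_mul_exp_neg_mul_sq {b : ℝ} (hb : 0 < b) (n : ℕ) :
    Integrable fun s : ℝ => |s| ^ n * Real.exp (-b * s ^ 2) := by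
  have h := (integrable_rpow_mul_exp_neg_mul_sq (s := n) hb
    (by have : (0 : ℝ) ≤ n := by positivity
        linarith)).norm
  refine h.congr (Eventually.of_forall fun s => ?_)
  simp only [Real.rpow_natCast]
  rw [norm_mul, Real.norm_of_nonneg (Real.exp_pos _).le, norm_pow, Real.norm_eq_abs]

lemma fourierInvReal_gaussian (y : ℝ) :
    fourierInvReal (fun s => (Real.exp (-s ^ 2 / 2) : ℂ)) y
      = (1 / Real.sqrt (2 * Real.pi) * Real.exp (-y ^ 2 / 2) : ℝ) := by
  have h := charFun_gaussianReal (μ := 0) (v := 1) (-y)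
  rw [charFun_apply_real, integral_gaussianReal_eq_integral_smul (by simp)] at h
  have e : ∀ x : ℝ, gaussianPDFReal 0 1 x • Complex.exp ((-y : ℝ) * x * Complex.I)
      = ((Real.sqrt (2 * Real.pi))⁻¹ : ℝ) * (Complex.exp ((-(x * y) : ℝ) * Complex.I)
        * (Real.exp (-x ^ 2 / 2) : ℂ)) := by
    intro x
    rw [gaussianPDFReal, Complex.real_smul]
    simp only [NNReal.coe_one, mul_one, sub_zero]
    push_cast
    rw [show -(y : ℂ) * x * Complex.I = -(x * y) * Complex.I by ring]
    ring
  simp_rw [e] at h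
  rw [integral_const_mul] at h
  have hs : (0 : ℝ) < Real.sqrt (2 * Real.pi) := by positivity
  -- One factor `(2π)^{-1/2}` normalizes the Gaussian weight in the integral; the other is the
  -- constant of the resulting density.
  have h2 : (2 * Real.pi)⁻¹ = (Real.sqrt (2 * Real.pi))⁻¹ * (Real.sqrt (2 * Real.pi))⁻¹ := by
    rw [← mul_inv, Real.mul_self_sqrt (by positivity)]
  rw [fourierInvReal, h2, Complex.ofReal_mul, mul_assoc, h]
  push_cast
  rw [one_div]
  congr 2
  simp
  ring

/-- The difference between the (inverse) Fourier integrands of the standardized multi-jump density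
and of the standard normal density. -/
noncomputable def stdError (μ : Measure ℝ) (σ s : ℝ) : ℂ :=
  Complex.exp ((-(s / σ * ∫ x, x ∂μ) : ℝ) * Complex.I) * multiJumpCharFun μ (s / σ)
    - Real.exp (-s ^ 2 / 2)

section StdError
variable {μ : Measure ℝ} {B : NNReal} {σ : ℝ}

lemma integrable_scaled_multiJumpCharFun [IsFiniteMeasure μ] (hB : μ ≤ B • (volume : Measure ℝ)) (hσ : 0 < σ) :
    Integrable fun s => Complex.exp ((-(s / σ * ∫ x, x ∂μ) : ℝ) * Complex.I)
      * multiJumpCharFun μ (s / σ) := by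
  have h := (integrable_multiJumpCharFun hB).comp_div hσ.ne'
  refine h.norm.mono' (AEStronglyMeasurable.mul (Continuous.aestronglyMeasurable (by fun_prop))
    h.aestronglyMeasurable) (Eventually.of_forall fun s => ?_)
  rw [norm_cexp_neg_mul_I_mul]

lemma integrable_stdError [IsFiniteMeasure μ] (hB : μ ≤ B • (volume : Measure ℝ)) (hσ : 0 < σ) :
    Integrable (stdError μ σ) :=
  (integrable_scaled_multiJumpCharFun hB hσ).sub integrable_gaussian_weight.ofReal

/-- Substituting `u = s/σ` in the inversion integral absorbs the factor `σ` and turns the mean into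
the phase built into `stdError`. -/
lemma fourierInvReal_stdError [IsFiniteMeasure μ] (hB : μ ≤ B • (volume : Measure ℝ)) (hσ : 0 < σ) (y : ℝ) :
    σ * fourierInvReal (multiJumpCharFun μ) ((∫ x, x ∂μ) + σ * y)
      - (1 / Real.sqrt (2 * Real.pi) * Real.exp (-y ^ 2 / 2) : ℝ)
      = fourierInvReal (stdError μ σ) y := by
  have h1 : (σ : ℂ) * ∫ u : ℝ, Complex.exp ((-(u * ((∫ x, x ∂μ) + σ * y)) : ℝ) * Complex.I)
        * multiJumpCharFun μ u
      = ∫ s : ℝ, Complex.exp ((-(s * y) : ℝ) * Complex.I)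
        * (Complex.exp ((-(s / σ * ∫ x, x ∂μ) : ℝ) * Complex.I) * multiJumpCharFun μ (s / σ)) := by
    have h2 := Measure.integral_comp_div (fun u : ℝ =>
      Complex.exp ((-(u * ((∫ x, x ∂μ) + σ * y)) : ℝ) * Complex.I) * multiJumpCharFun μ u) σ
    rw [abs_of_pos hσ, Complex.real_smul] at h2
    rw [← h2]
    refine integral_congr_ae (Eventually.of_forall fun s => ?_)
    simp only
    rw [← mul_assoc, ← Complex.exp_add]
    congr 2
    have : (σ : ℂ) ≠ 0 := by exact_mod_cast hσ.ne'
    push_cast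
    field_simp
    ring
  rw [← fourierInvReal_gaussian, fourierInvReal, fourierInvReal, fourierInvReal, mul_left_comm, h1,
    ← mul_sub, ← integral_sub]
  · congr 1
    refine integral_congr_ae (Eventually.of_forall fun s => ?_)
    simp only [stdError]
    ring
  · have h := integrable_scaled_multiJumpCharFun hB hσ
    refine h.norm.mono' (AEStronglyMeasurable.mul (Continuous.aestronglyMeasurable (by fun_prop))
      h.aestronglyMeasurable) (Eventually.of_forall fun s => ?_)
    rw [norm_cexp_neg_mul_I_mul]
  · have h : Integrable fun s : ℝ => (Real.exp (-s ^ 2 / 2) : ℂ) :=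
      integrable_gaussian_weight.ofReal
    refine h.norm.mono' (Continuous.aestronglyMeasurable (by fun_prop))
      (Eventually.of_forall fun s => ?_)
    rw [norm_cexp_neg_mul_I_mul]

lemma setIntegral_compl_norm_stdError_le [IsFiniteMeasure μ] (hB : μ ≤ B • (volume : Measure ℝ)) (hσ : 0 < σ) {D : ℝ}
    (hD : D ≤ μ.real univ)
    (htail : ∀ t, Real.pi ≤ |t| → (charFun μ t).re ≤ μ.real univ - D) :
    ∫ s in (Icc (-(Real.pi * σ)) (Real.pi * σ))ᶜ, ‖stdError μ σ s‖
      ≤ σ * Real.exp (-D) * (2 * Real.pi * B * μ.real univ)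
        + (∫ s : ℝ, |s| ^ 2 * Real.exp (-(1 / 2) * s ^ 2)) / σ ^ 2 := by
  have hi1 : Integrable fun s => Real.exp (-D) * ‖charFun μ (s / σ)‖ ^ 2 :=
    ((integrable_normSq_charFun hB).comp_div hσ.ne').const_mul _
  have hi2 : Integrable fun s : ℝ => |s| ^ 2 * Real.exp (-(1 / 2) * s ^ 2) / σ ^ 2 :=
    (integrable_pow_mul_exp_neg_mul_sq (by norm_num) 2).div_const _
  calc _ ≤ ∫ s in (Icc (-(Real.pi * σ)) (Real.pi * σ))ᶜ, (Real.exp (-D) * ‖charFun μ (s / σ)‖ ^ 2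
        + |s| ^ 2 * Real.exp (-(1 / 2) * s ^ 2) / σ ^ 2) := by
        refine setIntegral_mono_on (integrable_stdError hB hσ).norm.integrableOn
          (hi1.add hi2).integrableOn measurableSet_Icc.compl fun s hs => ?_
        have hs' : Real.pi * σ < |s| := by
          by_contra hcon
          exact hs (mem_Icc.2 (abs_le.1 (not_lt.1 hcon)))
        have ht : Real.pi ≤ |s / σ| := by
          rw [abs_div, abs_of_pos hσ, le_div_iff₀ hσ]
          exact hs'.le
        rw [stdError]
        refine (norm_sub_le _ _).trans ?_
        rw [norm_cexp_neg_mul_I_mul, Complex.norm_real, Real.norm_of_nonneg (by positivity)]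
        refine add_le_add (norm_multiJumpCharFun_le hD (htail _ ht)) ?_
        -- Here `1 ≤ s²/σ²`, which trades the Gaussian tail for a factor `1/σ²`.
        have hσs : σ ≤ |s| := by nlinarith [Real.pi_gt_three]
        rw [le_div_iff₀ (by positivity), mul_comm, show -(1 / 2) * s ^ 2 = -s ^ 2 / 2 by ring]
        gcongr
    _ ≤ ∫ s, (Real.exp (-D) * ‖charFun μ (s / σ)‖ ^ 2
        + |s| ^ 2 * Real.exp (-(1 / 2) * s ^ 2) / σ ^ 2) :=
        setIntegral_le_integral (hi1.add hi2) (Eventually.of_forall fun s => by positivity)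
    _ = Real.exp (-D) * (σ * ∫ t, ‖charFun μ t‖ ^ 2)
        + (∫ s : ℝ, |s| ^ 2 * Real.exp (-(1 / 2) * s ^ 2)) / σ ^ 2 := by
        rw [integral_add hi1 hi2, integral_const_mul, integral_div,
          Measure.integral_comp_div (fun t => ‖charFun μ t‖ ^ 2) σ, abs_of_pos hσ, smul_eq_mul]
    _ ≤ _ := by
        rw [← mul_assoc, mul_comm (Real.exp (-D)) σ]
        gcongr
        exact integral_normSq_charFun_le hB

/-- `exp (stdLogCharFun μ σ s)` is the full standardized characteristic function. The difference is
exactly the contribution of zero or one jump, `e^{-λ}(1 + φ)` up to a phase. -/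
lemma norm_stdError_sub_le (s : ℝ) :
    ‖stdError μ σ s - (Complex.exp (stdLogCharFun μ σ s) - Complex.exp (-s ^ 2 / 2 : ℝ))‖
      ≤ Real.exp (-μ.real univ) * (1 + μ.real univ) := by
  have e : stdError μ σ s - (Complex.exp (stdLogCharFun μ σ s) - Complex.exp (-s ^ 2 / 2 : ℝ))
      = -(Complex.exp ((-(s / σ * ∫ x, x ∂μ) : ℝ) * Complex.I)
        * (Real.exp (-μ.real univ) * (1 + charFun μ (s / σ)))) := by
    have h : stdLogCharFun μ σ s = (-(s / σ * ∫ x, x ∂μ) : ℝ) * Complex.I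
        + ((-μ.real univ : ℝ) + charFun μ (s / σ)) := by
      rw [stdLogCharFun]
      push_cast
      ring
    rw [stdError, multiJumpCharFun, h, Complex.exp_add, Complex.exp_add, Complex.ofReal_exp,
      Complex.ofReal_exp]
    ring
  rw [e, norm_neg, norm_cexp_neg_mul_I_mul, norm_mul, Complex.norm_real,
    Real.norm_of_nonneg (by positivity)]
  gcongr
  refine (norm_add_le _ _).trans ?_
  rw [norm_one]
  gcongr
  exact norm_charFun_le _

lemma continuous_stdLogCharFun [IsFiniteMeasure μ] :
    Continuous (stdLogCharFun μ σ) := by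
  have hc : Continuous (charFun μ) := continuous_charFun
  unfold stdLogCharFun
  fun_prop

end StdError

/-- Gaussian-type absolute moments. -/
noncomputable def expSqMoment (b : ℝ) (n : ℕ) : ℝ := ∫ s : ℝ, |s| ^ n * Real.exp (-b * s ^ 2)

lemma expSqMoment_nonneg (b : ℝ) (n : ℕ) : 0 ≤ expSqMoment b n :=
  integral_nonneg fun s => by positivity

section StdError
variable {μ : Measure ℝ} [IsFiniteMeasure μ] {B : NNReal} {σ : ℝ}

/-- Puts the Gaussian exponent in the half-plane of `re_stdLogCharFun_le`, so that both exponentials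
share one bound. -/
lemma neg_sq_div_two_le (s : ℝ) : -s ^ 2 / 2 ≤ -(2 / Real.pi ^ 2) * s ^ 2 := by
  have hp : 2 / Real.pi ^ 2 ≤ 1 / 2 := by
    rw [div_le_div_iff₀ (by positivity) (by norm_num)]
    nlinarith [Real.pi_gt_three]
  nlinarith [sq_nonneg s]

lemma norm_cexp_stdLogCharFun_sub_le (hμ : ∀ᵐ x ∂μ, x ∈ Icc (0 : ℝ) 1) {s : ℝ} (hσ : 0 < σ)
    (hσ2 : σ ^ 2 = ∫ x, x ^ 2 ∂μ) (hs : |s| ≤ Real.pi * σ) :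
    ‖Complex.exp (stdLogCharFun μ σ s) - Complex.exp (-s ^ 2 / 2 : ℝ)‖
      ≤ Real.exp Real.pi / σ * (|s| ^ 3 * Real.exp (-(2 / Real.pi ^ 2) * s ^ 2)) := by
  refine (norm_cexp_sub_cexp_le (re_stdLogCharFun_le hμ hσ hσ2 hs)
    (by rw [Complex.ofReal_re]; exact neg_sq_div_two_le s)).trans ?_
  calc _ ≤ Real.exp (-(2 / Real.pi ^ 2) * s ^ 2) * (Real.exp Real.pi * |s| ^ 3 / σ) := by
        gcongr
        exact norm_stdLogCharFun_add_le hμ hσ hσ2 hs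
    _ = _ := by ring

lemma norm_cexp_stdLogCharFun_sub_sub_le (hμ : ∀ᵐ x ∂μ, x ∈ Icc (0 : ℝ) 1) {s : ℝ} (hσ : 0 < σ)
    (hσ2 : σ ^ 2 = ∫ x, x ^ 2 ∂μ) (hs : |s| ≤ Real.pi * σ) :
    ‖Complex.exp (stdLogCharFun μ σ s) - Complex.exp (-s ^ 2 / 2 : ℝ)
      - (-(∫ x, x ^ 3 ∂μ) / (6 * σ ^ 3) : ℝ) * Complex.I
        * ((s ^ 3 * Real.exp (-s ^ 2 / 2) : ℝ) : ℂ)‖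
      ≤ Real.exp Real.pi ^ 2 / σ ^ 2 * (|s| ^ 6 * Real.exp (-(2 / Real.pi ^ 2) * s ^ 2))
        + Real.exp Real.pi / σ ^ 2 * (|s| ^ 4 * Real.exp (-(2 / Real.pi ^ 2) * s ^ 2)) := by
  set z := stdLogCharFun μ σ s
  set w : ℂ := ((-s ^ 2 / 2 : ℝ) : ℂ) with hw
  set c : ℂ := (-(∫ x, x ^ 3 ∂μ) / (6 * σ ^ 3) : ℝ) * Complex.I
  have hwre : w.re ≤ -(2 / Real.pi ^ 2) * s ^ 2 := by
    rw [Complex.ofReal_re]; exact neg_sq_div_two_le s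
  -- The second-order remainder of the exponential is of size `|z - w|²`, giving `s⁶/σ²`. The error
  -- in approximating `z - w` by the cubic term gives `s⁴/σ²`.
  have e : Complex.exp z - Complex.exp w - c * ((s ^ 3 * Real.exp (-s ^ 2 / 2) : ℝ) : ℂ)
      = (Complex.exp z - Complex.exp w - (z - w) * Complex.exp w)
        + (z - w - c * (s ^ 3 : ℝ)) * Complex.exp w := by
    rw [hw, Complex.ofReal_mul, Complex.ofReal_exp]
    ring
  rw [e]
  refine (norm_add_le _ _).trans (add_le_add ?_ ?_)
  · refine (norm_cexp_sub_cexp_sub_mul_le (re_stdLogCharFun_le hμ hσ hσ2 hs) hwre).trans ?_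
    calc _ ≤ Real.exp (-(2 / Real.pi ^ 2) * s ^ 2) * (Real.exp Real.pi * |s| ^ 3 / σ) ^ 2 := by
          gcongr
          exact norm_stdLogCharFun_add_le hμ hσ hσ2 hs
      _ = _ := by ring
  · rw [norm_mul, Complex.norm_exp]
    calc _ ≤ (Real.exp Real.pi * s ^ 4 / σ ^ 2) * Real.exp (-(2 / Real.pi ^ 2) * s ^ 2) := by
          gcongr
          exact norm_stdLogCharFun_add_sub_le hμ hσ hσ2 hs
      _ = _ := by
          rw [Even.pow_abs (by decide)]
          ring

lemma setIntegral_norm_remainder_le {σ : ℝ} (hσ : 0 < σ) {f : ℝ → ℂ} {C : ℝ}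
    (hf : Measurable f) (hC : ∀ s, ‖f s‖ ≤ C) :
    ∫ s in Icc (-(Real.pi * σ)) (Real.pi * σ), ‖f s‖ ≤ 2 * Real.pi * σ * C := by
  have hp : 0 < Real.pi * σ := by positivity
  calc _ ≤ ∫ s in Icc (-(Real.pi * σ)) (Real.pi * σ), C :=
        setIntegral_mono_on (Integrable.mono' (integrable_const C)
          hf.norm.aestronglyMeasurable (Eventually.of_forall fun s => by simpa using hC s))
          (integrable_const C) measurableSet_Icc fun s _ => hC s
    _ = _ := by
        rw [setIntegral_const, measureReal_def, Real.volume_Icc,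
          ENNReal.toReal_ofReal (by linarith), smul_eq_mul]
        ring

lemma setIntegral_Icc_norm_stdError_le (hB : μ ≤ B • (volume : Measure ℝ))
    (hμ : ∀ᵐ x ∂μ, x ∈ Icc (0 : ℝ) 1) (hσ : 0 < σ) (hσ2 : σ ^ 2 = ∫ x, x ^ 2 ∂μ) :
    ∫ s in Icc (-(Real.pi * σ)) (Real.pi * σ), ‖stdError μ σ s‖
      ≤ 2 * Real.pi * σ * (Real.exp (-μ.real univ) * (1 + μ.real univ))
        + Real.exp Real.pi / σ * expSqMoment (2 / Real.pi ^ 2) 3 := by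
  set A := Icc (-(Real.pi * σ)) (Real.pi * σ) with hA
  have hcont : Continuous fun s => Complex.exp (stdLogCharFun μ σ s)
      - Complex.exp (-s ^ 2 / 2 : ℝ) := by
    have := continuous_stdLogCharFun (μ := μ) (σ := σ)
    fun_prop
  have hi0 := (integrable_stdError hB hσ).integrableOn (s := A)
  have hi1 : IntegrableOn (fun s => Complex.exp (stdLogCharFun μ σ s)
      - Complex.exp (-s ^ 2 / 2 : ℝ)) A := hcont.continuousOn.integrableOn_compact isCompact_Icc
  have hi2 := (integrable_pow_mul_exp_neg_mul_sq (b := 2 / Real.pi ^ 2) (by positivity) 3).const_mul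
    (Real.exp Real.pi / σ)
  have hm : Measurable fun s => stdError μ σ s - (Complex.exp (stdLogCharFun μ σ s)
      - Complex.exp (-s ^ 2 / 2 : ℝ)) := by
    have := measurable_charFun (μ := μ)
    have h2 : Measurable (stdError μ σ) := by
      unfold stdError multiJumpCharFun
      fun_prop
    exact h2.sub hcont.measurable
  calc _ ≤ ∫ s in A, (‖stdError μ σ s - (Complex.exp (stdLogCharFun μ σ s)
        - Complex.exp (-s ^ 2 / 2 : ℝ))‖ + ‖Complex.exp (stdLogCharFun μ σ s)
        - Complex.exp (-s ^ 2 / 2 : ℝ)‖) :=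
        integral_mono hi0.norm ((hi0.sub hi1).norm.add hi1.norm) fun s =>
          norm_le_norm_sub_add _ _
    _ = (∫ s in A, ‖stdError μ σ s - (Complex.exp (stdLogCharFun μ σ s)
        - Complex.exp (-s ^ 2 / 2 : ℝ))‖) + ∫ s in A, ‖Complex.exp (stdLogCharFun μ σ s)
        - Complex.exp (-s ^ 2 / 2 : ℝ)‖ := integral_add (hi0.sub hi1).norm hi1.norm
    _ ≤ _ := by
        refine add_le_add (setIntegral_norm_remainder_le hσ hm norm_stdError_sub_le) ?_
        rw [expSqMoment, ← integral_const_mul]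
        refine (setIntegral_mono_on hi1.norm hi2.integrableOn measurableSet_Icc fun s hs =>
          norm_cexp_stdLogCharFun_sub_le hμ hσ hσ2 (abs_le.2 hs)).trans ?_
        exact setIntegral_le_integral hi2 (Eventually.of_forall fun s => by positivity)

lemma setIntegral_Icc_odd_eq_zero (R : ℝ) :
    ∫ s in Icc (-R) R, ((s ^ 3 * Real.exp (-s ^ 2 / 2) : ℝ) : ℂ) = 0 := by
  have h := integral_neg_eq_self (fun s : ℝ => (Icc (-R) R).indicator
    (fun s => ((s ^ 3 * Real.exp (-s ^ 2 / 2) : ℝ) : ℂ)) s) volume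
  rw [← integral_indicator measurableSet_Icc]
  have e : ∀ s : ℝ, (Icc (-R) R).indicator (fun s => ((s ^ 3 * Real.exp (-s ^ 2 / 2) : ℝ) : ℂ)) (-s)
      = -(Icc (-R) R).indicator (fun s => ((s ^ 3 * Real.exp (-s ^ 2 / 2) : ℝ) : ℂ)) s := by
    intro s
    by_cases hs : s ∈ Icc (-R) R
    · have hs' : -s ∈ Icc (-R) R := ⟨by linarith [hs.2], by linarith [hs.1]⟩
      rw [indicator_of_mem hs, indicator_of_mem hs']
      push_cast
      ring_nf
    · have hs' : -s ∉ Icc (-R) R := fun h' => hs ⟨by linarith [h'.2], by linarith [h'.1]⟩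
      rw [indicator_of_notMem hs, indicator_of_notMem hs', neg_zero]
  simp_rw [e] at h
  rw [integral_neg] at h
  linear_combination (-1 / 2 : ℂ) * h

/-- The term of order `1/σ` is an odd function times a constant and cancels over the symmetric
interval. The norm must therefore stay outside the integral until it has been removed. -/
lemma norm_setIntegral_Icc_stdError_le (hB : μ ≤ B • (volume : Measure ℝ))
    (hμ : ∀ᵐ x ∂μ, x ∈ Icc (0 : ℝ) 1) (hσ : 0 < σ) (hσ2 : σ ^ 2 = ∫ x, x ^ 2 ∂μ) :
    ‖∫ s in Icc (-(Real.pi * σ)) (Real.pi * σ), stdError μ σ s‖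
      ≤ 2 * Real.pi * σ * (Real.exp (-μ.real univ) * (1 + μ.real univ))
        + (Real.exp Real.pi ^ 2 / σ ^ 2 * expSqMoment (2 / Real.pi ^ 2) 6
          + Real.exp Real.pi / σ ^ 2 * expSqMoment (2 / Real.pi ^ 2) 4) := by
  set A := Icc (-(Real.pi * σ)) (Real.pi * σ) with hA
  set c : ℂ := (-(∫ x, x ^ 3 ∂μ) / (6 * σ ^ 3) : ℝ) * Complex.I with hc
  have hcont : Continuous fun s => Complex.exp (stdLogCharFun μ σ s)
      - Complex.exp (-s ^ 2 / 2 : ℝ) := by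
    have := continuous_stdLogCharFun (μ := μ) (σ := σ)
    fun_prop
  have hcont3 : Continuous fun s : ℝ => c * ((s ^ 3 * Real.exp (-s ^ 2 / 2) : ℝ) : ℂ) := by
    fun_prop
  have hi0 := (integrable_stdError hB hσ).integrableOn (s := A)
  have hi1 : IntegrableOn (fun s => Complex.exp (stdLogCharFun μ σ s)
      - Complex.exp (-s ^ 2 / 2 : ℝ)) A := hcont.continuousOn.integrableOn_compact isCompact_Icc
  have hi3 : IntegrableOn (fun s : ℝ => c * ((s ^ 3 * Real.exp (-s ^ 2 / 2) : ℝ) : ℂ)) A :=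
    hcont3.continuousOn.integrableOn_compact isCompact_Icc
  have hi6 := (integrable_pow_mul_exp_neg_mul_sq (b := 2 / Real.pi ^ 2) (by positivity) 6).const_mul
    (Real.exp Real.pi ^ 2 / σ ^ 2)
  have hi4 := (integrable_pow_mul_exp_neg_mul_sq (b := 2 / Real.pi ^ 2) (by positivity) 4).const_mul
    (Real.exp Real.pi / σ ^ 2)
  have hm : Measurable fun s => stdError μ σ s - (Complex.exp (stdLogCharFun μ σ s)
      - Complex.exp (-s ^ 2 / 2 : ℝ)) := by
    have := measurable_charFun (μ := μ)
    have h2 : Measurable (stdError μ σ) := by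
      unfold stdError multiJumpCharFun
      fun_prop
    exact h2.sub hcont.measurable
  have e : ∫ s in A, stdError μ σ s = (∫ s in A, (stdError μ σ s
        - (Complex.exp (stdLogCharFun μ σ s) - Complex.exp (-s ^ 2 / 2 : ℝ))))
      + ∫ s in A, (Complex.exp (stdLogCharFun μ σ s) - Complex.exp (-s ^ 2 / 2 : ℝ)
        - c * ((s ^ 3 * Real.exp (-s ^ 2 / 2) : ℝ) : ℂ)) := by
    rw [integral_sub hi0 hi1, integral_sub hi1 hi3, integral_const_mul,
      setIntegral_Icc_odd_eq_zero]
    ring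
  rw [e]
  refine (norm_add_le _ _).trans (add_le_add ((norm_integral_le_integral_norm _).trans
    (setIntegral_norm_remainder_le hσ hm norm_stdError_sub_le))
    ((norm_integral_le_integral_norm _).trans ?_))
  rw [expSqMoment, expSqMoment, ← integral_const_mul, ← integral_const_mul, ← integral_add hi6 hi4]
  refine (setIntegral_mono_on (hi1.sub hi3).norm (hi6.add hi4).integrableOn measurableSet_Icc
    fun s hs => norm_cexp_stdLogCharFun_sub_sub_le hμ hσ hσ2 (abs_le.2 hs)).trans ?_
  exact setIntegral_le_integral (hi6.add hi4) (Eventually.of_forall fun s => by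
    simp only [Pi.zero_apply, Pi.add_apply]; positivity)

lemma two_pi_inv_le_one : (2 * Real.pi)⁻¹ ≤ 1 :=
  inv_le_one_of_one_le₀ (by linarith [Real.pi_gt_three])

lemma norm_fourierInvReal_stdError_le (hB : μ ≤ B • (volume : Measure ℝ))
    (hμ : ∀ᵐ x ∂μ, x ∈ Icc (0 : ℝ) 1) (hσ : 0 < σ) (hσ2 : σ ^ 2 = ∫ x, x ^ 2 ∂μ) {D : ℝ}
    (hD : D ≤ μ.real univ)
    (htail : ∀ t, Real.pi ≤ |t| → (charFun μ t).re ≤ μ.real univ - D) (y : ℝ) :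
    ‖fourierInvReal (stdError μ σ) y‖
      ≤ 2 * Real.pi * σ * (Real.exp (-μ.real univ) * (1 + μ.real univ))
        + Real.exp Real.pi / σ * expSqMoment (2 / Real.pi ^ 2) 3
        + (σ * Real.exp (-D) * (2 * Real.pi * B * μ.real univ)
          + expSqMoment (1 / 2) 2 / σ ^ 2) := by
  refine (norm_fourierInvReal_le _ _).trans ((mul_le_of_le_one_left
    (integral_nonneg fun s => norm_nonneg _) two_pi_inv_le_one).trans ?_)
  rw [← integral_add_compl (measurableSet_Icc (a := -(Real.pi * σ)) (b := Real.pi * σ))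
    (integrable_stdError hB hσ).norm]
  exact add_le_add (setIntegral_Icc_norm_stdError_le hB hμ hσ hσ2)
    (setIntegral_compl_norm_stdError_le hB hσ hD htail)

/-- At `y = 0` the oscillating factor is 1, so the odd cancellation on the central interval is
available. -/
lemma norm_fourierInvReal_stdError_zero_le (hB : μ ≤ B • (volume : Measure ℝ))
    (hμ : ∀ᵐ x ∂μ, x ∈ Icc (0 : ℝ) 1) (hσ : 0 < σ) (hσ2 : σ ^ 2 = ∫ x, x ^ 2 ∂μ) {D : ℝ}
    (hD : D ≤ μ.real univ)
    (htail : ∀ t, Real.pi ≤ |t| → (charFun μ t).re ≤ μ.real univ - D) :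
    ‖fourierInvReal (stdError μ σ) 0‖
      ≤ 2 * Real.pi * σ * (Real.exp (-μ.real univ) * (1 + μ.real univ))
        + (Real.exp Real.pi ^ 2 / σ ^ 2 * expSqMoment (2 / Real.pi ^ 2) 6
          + Real.exp Real.pi / σ ^ 2 * expSqMoment (2 / Real.pi ^ 2) 4)
        + (σ * Real.exp (-D) * (2 * Real.pi * B * μ.real univ)
          + expSqMoment (1 / 2) 2 / σ ^ 2) := by
  have e : fourierInvReal (stdError μ σ) 0 = (2 * Real.pi : ℝ)⁻¹ * ∫ s, stdError μ σ s := by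
    simp [fourierInvReal]
  rw [e, norm_mul, Complex.norm_real, Real.norm_of_nonneg (by positivity)]
  refine (mul_le_of_le_one_left (norm_nonneg _) two_pi_inv_le_one).trans ?_
  rw [← integral_add_compl (measurableSet_Icc (a := -(Real.pi * σ)) (b := Real.pi * σ))
    (integrable_stdError hB hσ)]
  exact (norm_add_le _ _).trans (add_le_add (norm_setIntegral_Icc_stdError_le hB hμ hσ hσ2)
    ((norm_integral_le_integral_norm _).trans
      (setIntegral_compl_norm_stdError_le hB hσ hD htail)))

end StdError

/-! ### A uniform gap for the cosine transform of a short interval. -/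

/-- For `v ≤ 1` the cubic Taylor term suffices, because `h ≤ 2v/3`. For `1 ≤ v ≤ 2` the Lipschitz
bound from `v = 1` does, and for `v ≥ 2` the trivial `|sin v| ≤ 1`. -/
lemma abs_sin_le_mul_one_sub {h v : ℝ} (hh0 : 0 < h) (hh : h ≤ 1 / 2) (hv : Real.pi * h / 2 ≤ v) :
    |Real.sin v| ≤ v * (1 - h ^ 2 / 5) := by
  have hpi := Real.pi_gt_three
  have hv0 : 0 < v := lt_of_lt_of_le (by positivity) hv
  have hvh : 3 * h / 2 ≤ v := by nlinarith
  rcases le_total v 1 with h1 | h1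
  · have hb := Real.sin_bound (x := v) (by rw [abs_of_pos hv0]; exact h1)
    rw [abs_of_pos hv0] at hb
    have hs : 0 ≤ Real.sin v := Real.sin_nonneg_of_nonneg_of_le_pi hv0.le (by linarith)
    rw [abs_of_nonneg hs]
    have hb2 := (abs_le.1 hb).2
    have h2 : h ^ 2 ≤ 4 / 9 * v ^ 2 := by nlinarith
    have h4 : v ^ 4 ≤ v ^ 3 := by
      have : 0 ≤ v ^ 3 := by positivity
      nlinarith
    have h5 : v * h ^ 2 ≤ 4 / 9 * v ^ 3 := by nlinarith
    have h6 : 0 ≤ v ^ 3 := by positivity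
    nlinarith
  · have hh2 : h ^ 2 ≤ 1 / 4 := by nlinarith
    rcases le_total v 2 with h2 | h2
    · have hs : 0 ≤ Real.sin v := Real.sin_nonneg_of_nonneg_of_le_pi hv0.le (by linarith)
      rw [abs_of_nonneg hs]
      have hb := (abs_le.1 (Real.sin_bound (x := 1) (by simp))).2
      have hl := (abs_le.1 (Real.abs_sin_sub_sin_le v 1)).2
      rw [abs_of_nonneg (by linarith : 0 ≤ v - 1)] at hl
      norm_num at hb
      nlinarith
    · refine (Real.abs_sin_le_one v).trans ?_
      nlinarith

/-- With `u = |t|`, the integral of `cos(ux)` over a window of length `h` is at most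
`(2/u)|sin(uh/2)|`. Since `u ≥ π`, the sine bound applies at `v = uh/2`. -/
lemma le_setIntegral_one_sub_cos {h t : ℝ} (hh0 : 0 < h) (hh : h ≤ 1 / 2)
    (ht : Real.pi ≤ |t|) :
    h ^ 3 / 5 ≤ ∫ x in Icc (1 - h) 1, (1 - Real.cos (t * x)) := by
  have hcos : ∀ x, Real.cos (t * x) = Real.cos (|t| * x) := fun x => by
    rcases abs_choice t with h | h <;> rw [h]
    rw [neg_mul, Real.cos_neg]
  simp_rw [hcos]
  have hu : 0 < |t| := Real.pi_pos.trans_le ht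
  generalize |t| = u at *
  rw [integral_Icc_eq_integral_Ioc, ← intervalIntegral.integral_of_le (by linarith),
    intervalIntegral.integral_sub (by simp) (Continuous.intervalIntegrable (by fun_prop) _ _),
    intervalIntegral.integral_const, intervalIntegral.integral_comp_mul_left _ hu.ne',
    integral_cos, Real.sin_sub_sin, smul_eq_mul, smul_eq_mul]
  have h1 := abs_sin_le_mul_one_sub (v := u * h / 2) hh0 hh (by gcongr)
  rw [show (u * 1 - u * (1 - h)) / 2 = u * h / 2 by ring]
  have h2 : 2 * Real.sin (u * h / 2) * Real.cos ((u * 1 + u * (1 - h)) / 2)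
      ≤ u * h * (1 - h ^ 2 / 5) := by
    calc _ ≤ |2 * Real.sin (u * h / 2) * Real.cos ((u * 1 + u * (1 - h)) / 2)| := le_abs_self _
      _ ≤ 2 * |Real.sin (u * h / 2)| * 1 := by
        rw [abs_mul, abs_mul, abs_two]
        gcongr
        exact Real.abs_cos_le_one _
      _ ≤ _ := by linarith
  have h3 : u⁻¹ * (2 * Real.sin (u * h / 2) * Real.cos ((u * 1 + u * (1 - h)) / 2))
      ≤ h * (1 - h ^ 2 / 5) := by
    rw [inv_mul_le_iff₀ hu]
    linarith
  linarith

/-! ### The tilted jump measure: size, concentration near 1, and error bounds. -/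

/-- Bounds on a Lévy density supported on `[0, 1]`. -/
structure LevyDensityBounds (g : ℝ → ℝ) (M ε : ℝ) : Prop where
  measurable : Measurable g
  nonneg : ∀ x, 0 ≤ g x
  le : ∀ x, g x ≤ M
  zero : ∀ x, x ∉ Icc (0 : ℝ) 1 → g x = 0
  lower : ∀ x ∈ Icc (0 : ℝ) 1, 1 - ε ≤ x → ε ≤ g x
  one_le : 1 ≤ M
  pos : 0 < ε

/-- The jump measure `exp(β x) g(x) dx` of the tilted law. -/
noncomputable def tiltedJump (g : ℝ → ℝ) (β : ℝ) : Measure ℝ :=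
  volume.withDensity fun x => ENNReal.ofReal (Real.exp (β * x) * g x)

namespace LevyDensityBounds
variable {g : ℝ → ℝ} {M ε : ℝ}

lemma tilted_le (hg : LevyDensityBounds g M ε) (β x : ℝ) :
    Real.exp (β * x) * g x ≤ M * Real.exp |β| := by
  have hM := hg.one_le
  by_cases hx : x ∈ Icc (0 : ℝ) 1
  · rw [mul_comm]
    have : β * x ≤ |β| := by
      refine (le_abs_self _).trans ?_
      rw [abs_mul, abs_of_nonneg hx.1]
      exact mul_le_of_le_one_right (abs_nonneg _) hx.2
    have h0 := hg.nonneg x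
    gcongr
    exact hg.le x
  · rw [hg.zero x hx, mul_zero]
    positivity

lemma tiltedJump_le (hg : LevyDensityBounds g M ε) (β : ℝ) :
    tiltedJump g β ≤ (M * Real.exp |β|).toNNReal • (volume : Measure ℝ) := by
  have h : ((M * Real.exp |β|).toNNReal • (volume : Measure ℝ))
      = volume.withDensity fun _ => ENNReal.ofReal (M * Real.exp |β|) := by
    rw [withDensity_const]
    rfl
  rw [h]
  exact withDensity_mono (Eventually.of_forall fun x => ENNReal.ofReal_le_ofReal (hg.tilted_le β x))

lemma ae_mem_Icc (hg : LevyDensityBounds g M ε) (β : ℝ) :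
    ∀ᵐ x ∂(tiltedJump g β), x ∈ Icc (0 : ℝ) 1 := by
  have hm := hg.measurable
  rw [tiltedJump, ae_withDensity_iff (by fun_prop)]
  refine Eventually.of_forall fun x hx => ?_
  by_contra hcon
  simp [hg.zero x hcon] at hx

lemma integrable_tilted (hg : LevyDensityBounds g M ε) (β : ℝ) :
    Integrable fun x => Real.exp (β * x) * g x := by
  have hm := hg.measurable
  have h : Integrable ((Icc (0 : ℝ) 1).indicator fun _ => M * Real.exp |β|) :=
    (integrable_indicator_iff measurableSet_Icc).2 (integrableOn_const (by simp))
  refine h.mono' (by fun_prop) (Eventually.of_forall fun x => ?_)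
  rw [Real.norm_of_nonneg (mul_nonneg (Real.exp_pos _).le (hg.nonneg x))]
  by_cases hx : x ∈ Icc (0 : ℝ) 1
  · rw [indicator_of_mem hx]
    exact hg.tilted_le β x
  · rw [indicator_of_notMem hx, hg.zero x hx, mul_zero]

lemma isFiniteMeasure_tiltedJump (hg : LevyDensityBounds g M ε) (β : ℝ) :
    IsFiniteMeasure (tiltedJump g β) :=
  isFiniteMeasure_withDensity_ofReal (hg.integrable_tilted β).2

lemma real_univ_tiltedJump (hg : LevyDensityBounds g M ε) (β : ℝ) :
    (tiltedJump g β).real univ = ∫ x, Real.exp (β * x) * g x := by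
  rw [measureReal_def, tiltedJump, withDensity_apply _ MeasurableSet.univ, Measure.restrict_univ,
    ← ofReal_integral_eq_lintegral_ofReal (hg.integrable_tilted β)
      (Eventually.of_forall fun x => mul_nonneg (Real.exp_pos _).le (hg.nonneg x)),
    ENNReal.toReal_ofReal (integral_nonneg fun x => mul_nonneg (Real.exp_pos _).le (hg.nonneg x))]

lemma real_univ_tiltedJump_le (hg : LevyDensityBounds g M ε) {β : ℝ} (hβ : 0 < β) :
    (tiltedJump g β).real univ ≤ M * (Real.exp β / β) := by
  have hM := hg.one_le
  rw [hg.real_univ_tiltedJump]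
  have h1 : ∫ x, Real.exp (β * x) * g x ≤ ∫ x, (Icc (0 : ℝ) 1).indicator
      (fun x => Real.exp (β * x) * M) x := by
    refine integral_mono (hg.integrable_tilted β) ?_ fun x => ?_
    · rw [integrable_indicator_iff measurableSet_Icc]
      exact (Continuous.continuousOn (by fun_prop)).integrableOn_compact isCompact_Icc
    · by_cases hx : x ∈ Icc (0 : ℝ) 1
      · rw [indicator_of_mem hx]
        gcongr
        exact hg.le x
      · rw [indicator_of_notMem hx, hg.zero x hx, mul_zero]
  refine h1.trans ?_
  rw [integral_indicator measurableSet_Icc, integral_Icc_eq_integral_Ioc,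
    ← intervalIntegral.integral_of_le (by norm_num), intervalIntegral.integral_mul_const,
    intervalIntegral.integral_comp_mul_left _ hβ.ne', integral_exp, smul_eq_mul]
  rw [mul_zero, mul_one, Real.exp_zero, mul_comm, inv_mul_eq_div]
  gcongr
  linarith

/-- Lower bound for integrals against the tilted jump measure by the mass near `1`. -/
lemma le_integral_tiltedJump (hg : LevyDensityBounds g M ε) {β h : ℝ} (hβ : 0 ≤ β)
    (hh1 : h ≤ 1) (hhε : h ≤ ε) {f : ℝ → ℝ} (hf : Continuous f) (hf0 : ∀ x, 0 ≤ f x) :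
    ε * Real.exp (β * (1 - h)) * ∫ x in Icc (1 - h) 1, f x ≤ ∫ x, f x ∂(tiltedJump g β) := by
  have hm := hg.measurable
  have hε := hg.pos
  have := hg.isFiniteMeasure_tiltedJump β
  set c := ε * Real.exp (β * (1 - h)) with hc
  have hc0 : 0 ≤ c := by positivity
  have hle : c.toNNReal • (volume.restrict (Icc (1 - h) 1)) ≤ tiltedJump g β := by
    have e : c.toNNReal • (volume.restrict (Icc (1 - h) 1))
        = volume.withDensity ((Icc (1 - h) 1).indicator fun _ => ENNReal.ofReal c) := by
      rw [withDensity_indicator measurableSet_Icc, withDensity_const]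
      rfl
    rw [e]
    refine withDensity_mono (Eventually.of_forall fun x => ?_)
    by_cases hx : x ∈ Icc (1 - h) 1
    · simp only [indicator_of_mem hx]
      refine ENNReal.ofReal_le_ofReal ?_
      rw [hc, mul_comm]
      have hx0 : x ∈ Icc (0 : ℝ) 1 := ⟨by linarith [hx.1], hx.2⟩
      gcongr
      · exact hx.1
      · exact hg.lower x hx0 (by linarith [hx.1])
    · simp only [indicator_of_notMem hx]
      exact zero_le
  have h1 := integral_mono_measure hle (Eventually.of_forall hf0)
    (integrable_of_ae_mem_Icc (hg.ae_mem_Icc β) hf)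
  rw [integral_smul_nnreal_measure, NNReal.smul_def, Real.coe_toNNReal _ hc0, smul_eq_mul] at h1
  exact h1

lemma le_integral_sq_tiltedJump (hg : LevyDensityBounds g M ε) {β h : ℝ} (hβ : 0 ≤ β) (hh0 : 0 < h)
    (hh1 : h ≤ 1 / 2) (hhε : h ≤ ε) :
    ε * Real.exp (β * (1 - h)) * (h / 4) ≤ ∫ x, x ^ 2 ∂(tiltedJump g β) := by
  have hε := hg.pos
  refine le_trans ?_ (hg.le_integral_tiltedJump hβ (by linarith) hhε (continuous_pow 2)
    fun x => sq_nonneg x)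
  gcongr
  calc h / 4 = ∫ x in Icc (1 - h) 1, (1 / 4 : ℝ) := by
        rw [setIntegral_const, measureReal_def, Real.volume_Icc, ENNReal.toReal_ofReal (by linarith),
          smul_eq_mul]
        ring
    _ ≤ _ := by
        refine setIntegral_mono_on (integrable_const _)
          ((continuous_pow 2).continuousOn.integrableOn_compact isCompact_Icc)
          measurableSet_Icc fun x hx => ?_
        nlinarith [hx.1]

/-- `λ - Re φ(t)` is the integral of `1 - cos(tx)` against the jump measure, and the mass near 1
alone gives the gap. -/
lemma re_charFun_tiltedJump_le (hg : LevyDensityBounds g M ε) {β h : ℝ} (hβ : 0 ≤ β) (hh0 : 0 < h)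
    (hh1 : h ≤ 1 / 2) (hhε : h ≤ ε) {t : ℝ} (ht : Real.pi ≤ |t|) :
    (charFun (tiltedJump g β) t).re ≤ (tiltedJump g β).real univ
      - ε * Real.exp (β * (1 - h)) * (h ^ 3 / 5) := by
  have hε := hg.pos
  have := hg.isFiniteMeasure_tiltedJump β
  have h1 := hg.le_integral_tiltedJump hβ (by linarith) hhε
    (f := fun x => 1 - Real.cos (t * x)) (by fun_prop) fun x => by linarith [Real.cos_le_one (t * x)]
  rw [integral_sub (integrable_const _)
    (integrable_of_ae_mem_Icc (hg.ae_mem_Icc β) (by fun_prop)), ← re_charFun, integral_const,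
    smul_eq_mul, mul_one] at h1
  have h2 : ε * Real.exp (β * (1 - h)) * (h ^ 3 / 5)
      ≤ ε * Real.exp (β * (1 - h)) * ∫ x in Icc (1 - h) 1, (1 - Real.cos (t * x)) := by
    gcongr
    exact le_setIntegral_one_sub_cos hh0 hh1 ht
  linarith

end LevyDensityBounds

namespace LevyDensityBounds
variable {g : ℝ → ℝ} {M ε : ℝ}

/-- Mean of the tilted law in terms of its jump measure. -/
noncomputable def jumpMean (g : ℝ → ℝ) (β : ℝ) : ℝ := ∫ x, x ∂(tiltedJump g β)

/-- Standard deviation of the tilted law in terms of its jump measure. -/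
noncomputable def jumpSD (g : ℝ → ℝ) (β : ℝ) : ℝ := Real.sqrt (∫ x, x ^ 2 ∂(tiltedJump g β))

/-- The decay exponent of the characteristic function away from the origin. -/
noncomputable def decayExponent (ε β : ℝ) : ℝ :=
  ε * Real.exp (β * (1 - β⁻¹)) * (β⁻¹ ^ 3 / 5)

/-- The density of the standardized tilted law. -/
noncomputable def stdDensity (g : ℝ → ℝ) (β y : ℝ) : ℝ :=
  max (jumpSD g β * compoundPoissonDensity (fun x => Real.exp (β * x) * g x)
    (jumpMean g β + jumpSD g β * y)) 0

/-- Needed for every real `β`, since the decomposition into atom and density is claimed for every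
tilt. -/
lemma jumpSD_pos (hg : LevyDensityBounds g M ε) (β : ℝ) : 0 < jumpSD g β := by
  have hm := hg.measurable
  have hε := hg.pos
  refine Real.sqrt_pos.2 ?_
  have := hg.isFiniteMeasure_tiltedJump β
  have hi := integrable_of_ae_mem_Icc (hg.ae_mem_Icc β) (continuous_pow 2)
  rw [integral_pos_iff_support_of_nonneg (fun x => sq_nonneg x) hi]
  rw [tiltedJump, withDensity_apply _ (by measurability)]
  have hδ : 0 < min ε (1 / 2) := by positivity
  have hsub : Ioc (1 - min ε (1 / 2)) 1 ⊆ Function.support fun x : ℝ => x ^ 2 := by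
    intro x hx
    have : 0 < x := by linarith [hx.1, min_le_right ε (1 / 2)]
    simp [this.ne']
  refine lt_of_lt_of_le ?_ (lintegral_mono_set hsub)
  rw [setLIntegral_pos_iff (by fun_prop)]
  have hsub2 : Ioc (1 - min ε (1 / 2)) 1 ⊆ (Function.support fun x =>
      ENNReal.ofReal (Real.exp (β * x) * g x)) ∩ Ioc (1 - min ε (1 / 2)) 1 := by
    intro x hx
    refine ⟨?_, hx⟩
    have h0 : 0 < x := by linarith [hx.1, min_le_right ε (1 / 2)]
    have := hg.lower x ⟨h0.le, hx.2⟩ (by linarith [hx.1, min_le_left ε (1 / 2)])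
    simp only [Function.mem_support, ne_eq, ENNReal.ofReal_eq_zero, not_le]
    have : 0 < g x := hε.trans_le this
    positivity
  refine lt_of_lt_of_le ?_ (measure_mono hsub2)
  rw [Real.volume_Ioc, ENNReal.ofReal_pos]
  linarith

lemma jumpSD_sq (β : ℝ) : jumpSD g β ^ 2 = ∫ x, x ^ 2 ∂(tiltedJump g β) :=
  Real.sq_sqrt (integral_nonneg fun x => sq_nonneg x)

lemma jumpSD_sq_le (hg : LevyDensityBounds g M ε) (β : ℝ) : jumpSD g β ^ 2 ≤ jumpMean g β := by
  have := hg.isFiniteMeasure_tiltedJump β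
  rw [jumpSD_sq, jumpMean]
  simpa using integral_pow_le_integral_pow (hg.ae_mem_Icc β) (m := 1) (n := 2) (by norm_num)

lemma jumpMean_le (hg : LevyDensityBounds g M ε) (β : ℝ) :
    jumpMean g β ≤ (tiltedJump g β).real univ := by
  have := hg.isFiniteMeasure_tiltedJump β
  rw [jumpMean]
  simpa using integral_pow_le_integral_pow (hg.ae_mem_Icc β) (m := 0) (n := 1) (by norm_num)

/-- The single-jump density is bounded by its supremum, with the small prefactor `e^{-λ}`. The
multi-jump density minus the Gaussian is the inverse transform of `stdError`. -/
lemma abs_stdDensity_sub_le (hg : LevyDensityBounds g M ε) (β y : ℝ) :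
    |stdDensity g β y - 1 / Real.sqrt (2 * Real.pi) * Real.exp (-y ^ 2 / 2)|
      ≤ jumpSD g β * Real.exp (-(tiltedJump g β).real univ) * (M * Real.exp |β|)
        + ‖fourierInvReal (stdError (tiltedJump g β) (jumpSD g β)) y‖ := by
  have := hg.isFiniteMeasure_tiltedJump β
  have hσ := hg.jumpSD_pos β
  set σ := jumpSD g β
  set x := jumpMean g β + σ * y with hx
  have h1 := fourierInvReal_stdError (hg.tiltedJump_le β) hσ y
  have h2 := congrArg Complex.re h1
  rw [Complex.sub_re, Complex.ofReal_re, Complex.re_ofReal_mul] at h2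
  change σ * (fourierInvReal (multiJumpCharFun (tiltedJump g β)) x).re - _ = _ at h2
  have h0 : (0 : ℝ) ≤ 1 / Real.sqrt (2 * Real.pi) * Real.exp (-y ^ 2 / 2) := by positivity
  -- Truncation at 0 cannot increase the distance to the nonnegative Gaussian density.
  have h3 : |stdDensity g β y - 1 / Real.sqrt (2 * Real.pi) * Real.exp (-y ^ 2 / 2)|
      ≤ |σ * compoundPoissonDensity (fun x => Real.exp (β * x) * g x) x
        - 1 / Real.sqrt (2 * Real.pi) * Real.exp (-y ^ 2 / 2)| := by
    have := abs_max_sub_max_le_abs (σ * compoundPoissonDensity (fun x => Real.exp (β * x) * g x) x)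
      (1 / Real.sqrt (2 * Real.pi) * Real.exp (-y ^ 2 / 2)) 0
    rwa [max_eq_left h0] at this
  refine h3.trans ?_
  have h4 : σ * compoundPoissonDensity (fun x => Real.exp (β * x) * g x) x
        - 1 / Real.sqrt (2 * Real.pi) * Real.exp (-y ^ 2 / 2)
      = σ * Real.exp (-(tiltedJump g β).real univ) * (Real.exp (β * x) * g x)
        + (fourierInvReal (stdError (tiltedJump g β) σ) y).re := by
    rw [← h2]
    simp only [compoundPoissonDensity, tiltedJump]
    ring
  rw [h4]
  refine (abs_add_le _ _).trans (add_le_add ?_ (Complex.abs_re_le_norm _))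
  have h5 : 0 ≤ Real.exp (β * x) * g x := mul_nonneg (Real.exp_pos _).le (hg.nonneg x)
  rw [abs_of_nonneg (by positivity)]
  exact mul_le_mul_of_nonneg_left (hg.tilted_le β x) (by positivity)

/-- All error terms that are exponentially small, collected. -/
lemma exponentially_small_le {σ lam E D L M : ℝ} (hσ : 0 < σ) (hM : 1 ≤ M) (hL : 1 ≤ L)
    (hσE : σ ^ 2 ≤ E) (hEl : E ≤ lam) (hl : lam ≤ M * L) (hD : D ≤ lam)
    (hDL : Real.exp (-D) * L ^ 4 ≤ 1) :
    σ * Real.exp (-lam) * (M * L) + 2 * Real.pi * σ * (Real.exp (-lam) * (1 + lam))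
      + σ * Real.exp (-D) * (2 * Real.pi * (M * L) * lam) ≤ 30 * M ^ 4 / E := by
  have hE : 0 < E := lt_of_lt_of_le (by positivity) hσE
  have hlam : 0 < lam := hE.trans_le hEl
  have hX : 1 ≤ M * L := by nlinarith
  -- `X` dominates `σ`, `lam` and `E`. Each summand is then at most a constant times `e^{-D} X³`,
  -- and multiplying by `E ≤ X` gives `X⁴`: hence the powers `M⁴` and `L⁴`.
  set X := M * L with hXdef
  have hX0 : 0 < X := by linarith
  have hσX : σ ≤ X := by
    by_contra hcon
    push Not at hcon
    nlinarith
  have he : Real.exp (-lam) ≤ Real.exp (-D) := Real.exp_le_exp.2 (by linarith)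
  have hpi : Real.pi ≤ 4 := Real.pi_le_four
  have hX2 : X ^ 2 ≤ X ^ 3 := pow_le_pow_right₀ hX (by norm_num)
  rw [le_div_iff₀ hE]
  have t1 : σ * Real.exp (-lam) * X ≤ X * Real.exp (-D) * X := by gcongr
  have t2 : 2 * Real.pi * σ * (Real.exp (-lam) * (1 + lam))
      ≤ 2 * Real.pi * X * (Real.exp (-D) * (X + X)) := by gcongr
  have t3 : σ * Real.exp (-D) * (2 * Real.pi * X * lam)
      ≤ X * Real.exp (-D) * (2 * Real.pi * X * X) := by gcongr
  have hpi2 : Real.pi ≤ 3.15 := Real.pi_lt_d2.le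
  have t4 : X * Real.exp (-D) * X + 2 * Real.pi * X * (Real.exp (-D) * (X + X))
      + X * Real.exp (-D) * (2 * Real.pi * X * X) ≤ 30 * (Real.exp (-D) * X ^ 3) := by
    have hp := Real.exp_pos (-D)
    have e : X * Real.exp (-D) * X + 2 * Real.pi * X * (Real.exp (-D) * (X + X))
      + X * Real.exp (-D) * (2 * Real.pi * X * X)
      = Real.exp (-D) * (X ^ 2 + 4 * Real.pi * X ^ 2 + 2 * Real.pi * X ^ 3) := by ring
    rw [e, mul_left_comm]
    gcongr
    have hX3 : 0 ≤ X ^ 3 := by positivity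
    have hX20 : 0 ≤ X ^ 2 := by positivity
    nlinarith [mul_le_mul_of_nonneg_right hpi2 hX3, mul_le_mul_of_nonneg_right hpi2 hX20]
  calc _ ≤ 30 * (Real.exp (-D) * X ^ 3) * X :=
        mul_le_mul (by linarith) (hEl.trans hl) hE.le (by positivity)
    _ = 30 * M ^ 4 * (Real.exp (-D) * L ^ 4) := by rw [hXdef]; ring
    _ ≤ 30 * M ^ 4 * 1 := by gcongr
    _ = _ := mul_one _

lemma tendsto_exp_div_self : Tendsto (fun β : ℝ => Real.exp β / β) atTop atTop := by
  simpa using Real.tendsto_exp_div_pow_atTop 1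

lemma exp_mul_one_sub_inv {β : ℝ} (hβ : β ≠ 0) :
    Real.exp (β * (1 - β⁻¹)) = Real.exp (-1) * Real.exp β := by
  rw [← Real.exp_add]
  congr 1
  field_simp
  ring

lemma eventually_decayExponent (hε : 0 < ε) :
    ∀ᶠ β : ℝ in atTop, Real.exp (-decayExponent ε β) * Real.exp β ^ 4 ≤ 1 := by
  -- The claim is `D ≥ 4β`. Since `D = ε e^{-1} e^β / (5β³)`, this reads `e^β/β⁴ ≥ 20/(ε e^{-1})`.
  have h := (Real.tendsto_exp_div_pow_atTop 4).eventually_ge_atTop (20 / (ε * Real.exp (-1)))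
  filter_upwards [h, eventually_gt_atTop 0] with β h hβ
  rw [← Real.exp_nat_mul, ← Real.exp_add, Real.exp_le_one_iff, decayExponent,
    exp_mul_one_sub_inv hβ.ne']
  rw [div_le_div_iff₀ (by positivity) (by positivity)] at h
  have h2 : (4 : ℕ) * β ≤ ε * (Real.exp (-1) * Real.exp β) * (β⁻¹ ^ 3 / 5) := by
    rw [inv_pow, inv_eq_one_div, div_div, mul_one_div, le_div_iff₀ (by positivity)]
    push_cast
    nlinarith
  linarith

/-- For large tilts the standard deviation is comparable with the square root of the mean. -/
lemma eventually_le_jumpSD_sq (hg : LevyDensityBounds g M ε) :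
    ∀ᶠ β : ℝ in atTop, ε * Real.exp (-1) / 4 * (Real.exp β / β) ≤ jumpSD g β ^ 2 := by
  have hε := hg.pos
  filter_upwards [eventually_ge_atTop 2, eventually_ge_atTop (1 / ε)] with β h2 h1
  have hβ : 0 < β := by linarith
  -- The width `1/β` is the scale on which `exp(βx)` changes by a factor `e`, so the window captures
  -- a variance of order `e^β/β`, matching the upper bound for the mass.
  have h := hg.le_integral_sq_tiltedJump (β := β) (h := β⁻¹) hβ.le (by positivity)
    (by rw [one_div]; gcongr) (by rw [inv_le_comm₀ hβ hε, ← one_div]; exact h1)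
  rw [jumpSD_sq]
  refine le_trans (le_of_eq ?_) h
  rw [exp_mul_one_sub_inv hβ.ne']
  ring

theorem tendsto_jumpMean (hg : LevyDensityBounds g M ε) :
    Tendsto (jumpMean g) atTop atTop := by
  have hε := hg.pos
  refine tendsto_atTop_mono' _ ?_ (tendsto_exp_div_self.const_mul_atTop
    (by positivity : 0 < ε * Real.exp (-1) / 4))
  filter_upwards [hg.eventually_le_jumpSD_sq] with β h
  exact h.trans (hg.jumpSD_sq_le β)

lemma eventually_mul_jumpMean_le (hg : LevyDensityBounds g M ε) :
    ∀ᶠ β : ℝ in atTop, ε * Real.exp (-1) / (4 * M) * jumpMean g β ≤ jumpSD g β ^ 2 := by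
  have hε := hg.pos
  have hM := hg.one_le
  filter_upwards [hg.eventually_le_jumpSD_sq, eventually_gt_atTop 0] with β h hβ
  refine le_trans ?_ h
  have h1 := (hg.jumpMean_le β).trans (hg.real_univ_tiltedJump_le hβ)
  calc _ ≤ ε * Real.exp (-1) / (4 * M) * (M * (Real.exp β / β)) := by gcongr
    _ = _ := by field_simp

/-- The quantitative estimates for large tilts, in terms of the standard deviation and the mean. -/
theorem eventually_abs_stdDensity_sub_le (hg : LevyDensityBounds g M ε) :
    ∀ᶠ β : ℝ in atTop,
      (∀ y, |stdDensity g β y - 1 / Real.sqrt (2 * Real.pi) * Real.exp (-y ^ 2 / 2)|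
        ≤ Real.exp Real.pi * expSqMoment (2 / Real.pi ^ 2) 3 / jumpSD g β
          + expSqMoment (1 / 2) 2 / jumpSD g β ^ 2 + 30 * M ^ 4 / jumpMean g β) ∧
      |stdDensity g β 0 - 1 / Real.sqrt (2 * Real.pi)|
        ≤ (Real.exp Real.pi ^ 2 * expSqMoment (2 / Real.pi ^ 2) 6
          + Real.exp Real.pi * expSqMoment (2 / Real.pi ^ 2) 4
          + expSqMoment (1 / 2) 2) / jumpSD g β ^ 2 + 30 * M ^ 4 / jumpMean g β := by
  have hε := hg.pos
  have hM := hg.one_le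
  filter_upwards [eventually_ge_atTop 2, eventually_ge_atTop (1 / ε),
    eventually_decayExponent hε] with β h2 h1 hdec
  have hβ : 0 < β := by linarith
  have hfin := hg.isFiniteMeasure_tiltedJump β
  have hσ := hg.jumpSD_pos β
  have hinv2 : β⁻¹ ≤ 1 / 2 := by rw [one_div]; gcongr
  have hinvε : β⁻¹ ≤ ε := by rw [inv_le_comm₀ hβ hε, ← one_div]; exact h1
  have htail : ∀ t, Real.pi ≤ |t| → (charFun (tiltedJump g β) t).re
      ≤ (tiltedJump g β).real univ - decayExponent ε β := fun t ht =>
    hg.re_charFun_tiltedJump_le hβ.le (by positivity) hinv2 hinvε ht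
  -- `β⁻³/5 ≤ β⁻¹/4`, so `D` is below the lower bound for `σ²`, and `σ² ≤ E ≤ λ`.
  have hD : decayExponent ε β ≤ (tiltedJump g β).real univ := by
    refine le_trans ?_ (((hg.le_integral_sq_tiltedJump hβ.le (by positivity) hinv2 hinvε).trans
      ((jumpSD_sq β).symm.le)).trans ((hg.jumpSD_sq_le β).trans (hg.jumpMean_le β)))
    rw [decayExponent]
    have h0 : 0 < β⁻¹ := by positivity
    gcongr
    · exact pow_le_of_le_one h0.le (by linarith) (by norm_num)
    · norm_num
  have habs : |β| = β := abs_of_pos hβ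
  have hB : (((M * Real.exp |β|).toNNReal : NNReal) : ℝ) = M * Real.exp β := by
    rw [Real.coe_toNNReal _ (by positivity), habs]
  have hlam : (tiltedJump g β).real univ ≤ M * Real.exp β := by
    refine (hg.real_univ_tiltedJump_le hβ).trans ?_
    gcongr
    exact div_le_self (Real.exp_pos _).le (by linarith)
  have hsmall := exponentially_small_le hσ hM (Real.one_le_exp hβ.le) (hg.jumpSD_sq_le β)
    (hg.jumpMean_le β) hlam hD hdec
  refine ⟨fun y => ?_, ?_⟩
  · refine (hg.abs_stdDensity_sub_le β y).trans ((add_le_add_right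
      (norm_fourierInvReal_stdError_le (hg.tiltedJump_le β) (hg.ae_mem_Icc β) hσ
        (jumpSD_sq β) hD htail y) _).trans ?_)
    rw [hB, habs]
    have e : Real.exp Real.pi / jumpSD g β * expSqMoment (2 / Real.pi ^ 2) 3
      = Real.exp Real.pi * expSqMoment (2 / Real.pi ^ 2) 3 / jumpSD g β := by ring
    linarith
  · have h0 := hg.abs_stdDensity_sub_le β 0
    have e0 : 1 / Real.sqrt (2 * Real.pi) * Real.exp (-(0 : ℝ) ^ 2 / 2)
        = 1 / Real.sqrt (2 * Real.pi) := by simp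
    rw [e0] at h0
    refine h0.trans ((add_le_add_right
      (norm_fourierInvReal_stdError_zero_le (hg.tiltedJump_le β) (hg.ae_mem_Icc β) hσ
        (jumpSD_sq β) hD htail) _).trans ?_)
    rw [hB, habs]
    have e : Real.exp Real.pi ^ 2 / jumpSD g β ^ 2 * expSqMoment (2 / Real.pi ^ 2) 6
          + Real.exp Real.pi / jumpSD g β ^ 2 * expSqMoment (2 / Real.pi ^ 2) 4
          + expSqMoment (1 / 2) 2 / jumpSD g β ^ 2
        = (Real.exp Real.pi ^ 2 * expSqMoment (2 / Real.pi ^ 2) 6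
          + Real.exp Real.pi * expSqMoment (2 / Real.pi ^ 2) 4
          + expSqMoment (1 / 2) 2) / jumpSD g β ^ 2 := by ring
    linarith

theorem exists_abs_stdDensity_sub_le (hg : LevyDensityBounds g M ε) :
    (∃ K : ℝ, ∀ᶠ β : ℝ in atTop, ∀ y : ℝ,
      |stdDensity g β y - 1 / Real.sqrt (2 * Real.pi) * Real.exp (-y ^ 2 / 2)|
        ≤ K * (1 / Real.sqrt (jumpMean g β))) ∧
    (∃ K : ℝ, ∀ᶠ β : ℝ in atTop,
      |stdDensity g β 0 - 1 / Real.sqrt (2 * Real.pi)| ≤ K * (1 / jumpMean g β)) := by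
  have hε := hg.pos
  have hM := hg.one_le
  set c := ε * Real.exp (-1) / (4 * M) with hc
  have hc0 : 0 < c := by positivity
  have hinv : ∀ {A E s : ℝ}, 0 ≤ A → 0 < E → c * E ≤ s → A / s ≤ A / c * (1 / E) := by
    intro A E s hA hE hs
    rw [div_mul_div_comm, mul_one]
    gcongr
  constructor
  · refine ⟨Real.exp Real.pi * expSqMoment (2 / Real.pi ^ 2) 3 / Real.sqrt c
      + expSqMoment (1 / 2) 2 / c + 30 * M ^ 4, ?_⟩
    filter_upwards [hg.eventually_abs_stdDensity_sub_le, hg.eventually_mul_jumpMean_le,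
      hg.tendsto_jumpMean.eventually_ge_atTop 1] with β h hs hE y
    refine (h.1 y).trans ?_
    have hE0 : 0 < jumpMean g β := by linarith
    have hsE : 1 / jumpMean g β ≤ 1 / Real.sqrt (jumpMean g β) := by
      gcongr
      exact (Real.sqrt_le_left hE0.le).2 (by nlinarith)
    have hσ := hg.jumpSD_pos β
    have hsd : Real.sqrt c * Real.sqrt (jumpMean g β) ≤ jumpSD g β := by
      rw [← Real.sqrt_mul hc0.le]
      exact (Real.sqrt_le_left hσ.le).2 hs
    have a3 := expSqMoment_nonneg (2 / Real.pi ^ 2) 3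
    have a2 := expSqMoment_nonneg (1 / 2) 2
    have b1 : Real.exp Real.pi * expSqMoment (2 / Real.pi ^ 2) 3 / jumpSD g β
        ≤ Real.exp Real.pi * expSqMoment (2 / Real.pi ^ 2) 3 / Real.sqrt c
          * (1 / Real.sqrt (jumpMean g β)) := by
      rw [div_mul_div_comm, mul_one]
      gcongr
    have b2 := (hinv a2 hE0 hs).trans (mul_le_mul_of_nonneg_left hsE (by positivity))
    have b3 : 30 * M ^ 4 / jumpMean g β ≤ 30 * M ^ 4 * (1 / Real.sqrt (jumpMean g β)) := by
      rw [div_eq_mul_one_div]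
      gcongr
    linarith
  · refine ⟨(Real.exp Real.pi ^ 2 * expSqMoment (2 / Real.pi ^ 2) 6
          + Real.exp Real.pi * expSqMoment (2 / Real.pi ^ 2) 4
          + expSqMoment (1 / 2) 2) / c + 30 * M ^ 4, ?_⟩
    filter_upwards [hg.eventually_abs_stdDensity_sub_le, hg.eventually_mul_jumpMean_le,
      hg.tendsto_jumpMean.eventually_ge_atTop 1] with β h hs hE
    refine h.2.trans ?_
    have a6 := expSqMoment_nonneg (2 / Real.pi ^ 2) 6
    have a4 := expSqMoment_nonneg (2 / Real.pi ^ 2) 4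
    have a2 := expSqMoment_nonneg (1 / 2) 2
    rw [add_mul, mul_one_div (30 * M ^ 4)]
    gcongr
    exact hinv (by positivity) (by linarith) hs

end LevyDensityBounds

/-! ### Regularity of piecewise smooth functions. -/

/-- If `x` avoided every open piece and every node, induction would put all nodes below `x`,
including the last. -/
lemma exists_mem_Ioo_of_notMem_range {n : ℕ} {p : Fin (n + 1) → ℝ} {x : ℝ} (h0 : p 0 < x)
    (h1 : x < p (Fin.last n)) (hx : x ∉ range p) :
    ∃ i : Fin n, x ∈ Ioo (p i.castSucc) (p i.succ) := by
  by_contra hcon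
  push Not at hcon
  have h : ∀ j, p j < x := by
    intro j
    induction j using Fin.induction with
    | zero => exact h0
    | succ i ih =>
      have : ¬ x < p i.succ := fun h => hcon i ⟨ih, h⟩
      exact lt_of_le_of_ne (not_lt.1 this) fun h => hx ⟨_, h⟩
  exact (h _).not_gt h1

lemma exists_bound_Ioo {f : ℝ → ℝ} {a b la lb : ℝ} (hf : ContinuousOn f (Ioo a b))
    (ha : Tendsto f (𝓝[>] a) (𝓝 la)) (hb : Tendsto f (𝓝[<] b) (𝓝 lb)) :
    ∃ C, ∀ x ∈ Ioo a b, |f x| ≤ C := by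
  obtain ⟨C, hC⟩ := isCompact_Icc.exists_bound_of_continuousOn
    (continuousOn_Icc_extendFrom_Ioo hf ha hb)
  refine ⟨C, fun x hx => ?_⟩
  have := hC x (Ioo_subset_Icc_self hx)
  rwa [extendFrom_extends hf x hx, Real.norm_eq_abs] at this

lemma measurable_of_continuousAt_off_finite {f : ℝ → ℝ} {F : Set ℝ} (hF : F.Finite)
    (hf : ∀ x, x ∉ F → ContinuousAt f x) : Measurable f := by
  refine measurable_of_restrict_of_restrict_compl hF.measurableSet ?_ ?_
  · have := hF.to_subtype
    exact measurable_of_finite _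
  · exact (ContinuousOn.domRestrict fun x hx => (hf x hx).continuousWithinAt).measurable

/-- A piecewise `C^k` function on `[a, b]`, extended by zero, is continuous off a finite subset of
`[a, b]` and bounded. -/
lemma PiecewiseC.indicator_regular {k : ℕ} {g : ℝ → ℝ} {a b : ℝ} (h : PiecewiseC k g a b) :
    (∃ F : Set ℝ, F.Finite ∧ F ⊆ Icc a b ∧
      ∀ x, x ∉ F → ContinuousAt ((Icc a b).indicator g) x) ∧
    ∃ M, ∀ x ∈ Icc a b, |g x| ≤ M := by
  obtain ⟨n, p, hp, rfl, rfl, hi⟩ := h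
  have hcover : ∀ x ∈ Icc (p 0) (p (Fin.last n)), x ∉ range p →
      ∃ i : Fin n, x ∈ Ioo (p i.castSucc) (p i.succ) := fun x hx hxp =>
    exists_mem_Ioo_of_notMem_range (lt_of_le_of_ne hx.1 fun h => hxp ⟨_, h⟩)
      (lt_of_le_of_ne hx.2 fun h => hxp ⟨_, h.symm⟩) hxp
  constructor
  · refine ⟨range p, finite_range p, ?_, fun x hx => ?_⟩
    · rintro _ ⟨j, rfl⟩
      exact ⟨hp.monotone (Fin.zero_le j), hp.monotone (Fin.le_last j)⟩
    · by_cases hx' : x ∈ Icc (p 0) (p (Fin.last n))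
      · obtain ⟨i, hxi⟩ := hcover x hx' hx
        have hc : ContinuousAt g x :=
          (hi i).1.continuousOn.continuousAt (Ioo_mem_nhds hxi.1 hxi.2)
        refine hc.congr ?_
        filter_upwards [Ioo_mem_nhds hxi.1 hxi.2] with u hu
        rw [indicator_of_mem]
        exact ⟨(hp.monotone (Fin.zero_le _)).trans hu.1.le,
          hu.2.le.trans (hp.monotone (Fin.le_last _))⟩
      · refine (continuousAt_const (y := (0 : ℝ))).congr ?_
        filter_upwards [isClosed_Icc.isOpen_compl.mem_nhds hx'] with u hu
        rw [indicator_of_notMem hu]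
  · have hb : ∀ i : Fin n, ∃ C, ∀ x ∈ Ioo (p i.castSucc) (p i.succ), |g x| ≤ C := by
      intro i
      obtain ⟨⟨la, ha⟩, ⟨lb, hb⟩⟩ := (hi i).2 0 (Nat.zero_le _)
      rw [iteratedDeriv_zero] at ha hb
      exact exists_bound_Ioo (hi i).1.continuousOn ha hb
    choose C hC using hb
    -- The values at the nodes are arbitrary and enter the bound separately; absolute values let
    -- each sum dominate its terms.
    refine ⟨∑ i, |C i| + ∑ j, |g (p j)|, fun x hx => ?_⟩
    have s1 : 0 ≤ ∑ i, |C i| := Finset.sum_nonneg fun i _ => abs_nonneg _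
    have s2 : 0 ≤ ∑ j, |g (p j)| := Finset.sum_nonneg fun j _ => abs_nonneg _
    by_cases hxp : x ∈ range p
    · obtain ⟨j, rfl⟩ := hxp
      have := Finset.single_le_sum (f := fun j => |g (p j)|) (fun j _ => abs_nonneg _)
        (Finset.mem_univ j)
      linarith
    · obtain ⟨i, hxi⟩ := hcover x hx hxp
      have := Finset.single_le_sum (f := fun i => |C i|) (fun j _ => abs_nonneg _)
        (Finset.mem_univ i)
      linarith [hC i x hxi, le_abs_self (C i)]

/-! ### Identification and continuity of the standardized density. -/

namespace LevyDensityBounds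
variable {g : ℝ → ℝ} {M ε : ℝ}

lemma tiltedJump_zero_withDensity (hg : LevyDensityBounds g M ε) (β : ℝ) :
    (tiltedJump g 0).withDensity (fun x => ENNReal.ofReal (Real.exp (β * x))) = tiltedJump g β := by
  have hm := hg.measurable
  rw [tiltedJump, ← withDensity_mul _ (by fun_prop) (by fun_prop), tiltedJump]
  congr 1
  funext x
  rw [Pi.mul_apply, zero_mul, Real.exp_zero, one_mul, ← ENNReal.ofReal_mul (hg.nonneg x), mul_comm]

lemma integrableExpSet_tiltedJump (hg : LevyDensityBounds g M ε) :
    integrableExpSet id (tiltedJump g 0) = univ := by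
  have := hg.isFiniteMeasure_tiltedJump 0
  exact eq_univ_of_forall fun θ => integrable_of_ae_mem_Icc (hg.ae_mem_Icc 0)
    (f := fun x => Real.exp (θ * id x)) (by simp only [id]; fun_prop)

/-- The multi-jump density is continuous everywhere, so only the single-jump term `exp(βx) g(x)` can
break continuity. -/
lemma continuousAt_stdDensity (hg : LevyDensityBounds g M ε) {β y : ℝ}
    (h : ContinuousAt g (jumpMean g β + jumpSD g β * y)) : ContinuousAt (stdDensity g β) y := by
  have := hg.isFiniteMeasure_tiltedJump β
  have hH : Continuous (fourierInvReal (multiJumpCharFun (tiltedJump g β))) :=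
    continuous_fourierInvReal (integrable_multiJumpCharFun (hg.tiltedJump_le β))
  have hl : ContinuousAt (fun y => jumpMean g β + jumpSD g β * y) y := by fun_prop
  have hc : ContinuousAt (compoundPoissonDensity fun x => Real.exp (β * x) * g x)
      (jumpMean g β + jumpSD g β * y) := by
    have h1 : ContinuousAt (fun x => Real.exp (-(tiltedJump g β).real univ)
        * (Real.exp (β * x) * g x)
        + (fourierInvReal (multiJumpCharFun (tiltedJump g β)) x).re)
        (jumpMean g β + jumpSD g β * y) := by
      refine ContinuousAt.add (ContinuousAt.mul continuousAt_const
        (ContinuousAt.mul (by fun_prop) h)) ?_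
      exact (Complex.continuous_re.comp hH).continuousAt
    exact h1
  have hcomp : ContinuousAt (fun y => compoundPoissonDensity (fun x => Real.exp (β * x) * g x)
      (jumpMean g β + jumpSD g β * y)) y := ContinuousAt.comp (f := fun y =>
        jumpMean g β + jumpSD g β * y) hc hl
  exact (continuousAt_const.mul hcomp).max continuousAt_const

lemma measurable_compoundPoissonDensity (hg : LevyDensityBounds g M ε) (β : ℝ) :
    Measurable (compoundPoissonDensity fun x => Real.exp (β * x) * g x) := by
  have := hg.isFiniteMeasure_tiltedJump β
  have hm := hg.measurable
  have hH : Measurable fun x => (fourierInvReal (multiJumpCharFun (tiltedJump g β)) x).re :=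
    (Complex.continuous_re.comp (continuous_fourierInvReal
      (integrable_multiJumpCharFun (hg.tiltedJump_le β)))).measurable
  have h1 : Measurable fun x => Real.exp (-(tiltedJump g β).real univ) * (Real.exp (β * x) * g x)
        + (fourierInvReal (multiJumpCharFun (tiltedJump g β)) x).re := by fun_prop
  exact h1

end LevyDensityBounds

lemma map_withDensity_affine {h : ℝ → ℝ} (hh : Measurable h) {E σ : ℝ} (hσ : 0 < σ) :
    (volume.withDensity fun t => ENNReal.ofReal (h t)).map (fun t => (t - E) / σ)
      = volume.withDensity fun y => ENNReal.ofReal (max (σ * h (E + σ * y)) 0) := by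
  have hφ : Measurable fun t : ℝ => (t - E) / σ := by fun_prop
  have hvol : (volume : Measure ℝ).map (fun t => (t - E) / σ) = ENNReal.ofReal σ • volume := by
    have e : (fun t : ℝ => (t - E) / σ) = (fun t => σ⁻¹ * t) ∘ fun t => t - E := by
      funext t
      simp only [Function.comp]
      ring
    rw [e, ← Measure.map_map (by fun_prop) (by fun_prop), map_sub_right_eq_self,
      Real.map_volume_mul_left (inv_ne_zero hσ.ne'), inv_inv, abs_of_pos hσ]
  ext s hs
  rw [Measure.map_apply hφ hs, withDensity_apply _ (hφ hs), withDensity_apply _ hs,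
    ← lintegral_indicator (hφ hs), ← lintegral_indicator hs]
  have h1 : ∀ t, ((fun t : ℝ => (t - E) / σ) ⁻¹' s).indicator (fun t => ENNReal.ofReal (h t)) t
      = s.indicator (fun y => ENNReal.ofReal (h (E + σ * y))) ((t - E) / σ) := by
    intro t
    simp only [indicator, mem_preimage]
    rw [mul_div_cancel₀ _ hσ.ne', add_sub_cancel]
    rfl
  simp_rw [h1]
  rw [← lintegral_map (f := s.indicator fun y => ENNReal.ofReal (h (E + σ * y)))
    (Measurable.indicator (by fun_prop) hs) hφ, hvol, lintegral_smul_measure, smul_eq_mul,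
    ← lintegral_const_mul _ (Measurable.indicator (by fun_prop) hs)]
  refine lintegral_congr fun y => ?_
  by_cases hy : y ∈ s
  · rw [indicator_of_mem hy, indicator_of_mem hy, ← ENNReal.ofReal_mul hσ.le]
    simp
  · rw [indicator_of_notMem hy, indicator_of_notMem hy, mul_zero]

section Main
variable {g : ℝ → ℝ} {M ε : ℝ} {ν : Measure ℝ}

open LevyDensityBounds

/-- `compoundPoisson_eq` for the tilt, pushed forward by the standardizing map. The map is
injective, so the atom at 0 keeps its mass `e^{-λ} > 0`. -/
theorem isDefectiveDensity_standardizedTilt [IsProbabilityMeasure ν]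
    (hg : LevyDensityBounds g M ε)
    (h : ∀ θ, mgf id ν θ = Real.exp (mgf id (tiltedJump g 0) θ - (tiltedJump g 0).real univ))
    (hmean : ∀ β, tiltMean ν β = jumpMean g β) (hsd : ∀ β, tiltSD ν β = jumpSD g β) (β : ℝ) :
    IsDefectiveDensity (standardizedTilt ν β) (-(tiltMean ν β) / tiltSD ν β)
      (stdDensity g β) := by
  have hfin := hg.isFiniteMeasure_tiltedJump β
  have hσ := hg.jumpSD_pos β
  have hm := hg.measurable
  have hcm := hg.measurable_compoundPoissonDensity β
  have hfinν : IsFiniteMeasure (cramerTilt ν β) := by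
    rw [cramerTilt]
    infer_instance
  obtain ⟨hatom, heq⟩ := compoundPoisson_eq (ν := cramerTilt ν β) (μ := tiltedJump g β)
    (G := fun x => Real.exp (β * x) * g x) (by fun_prop)
    (fun x => mul_nonneg (Real.exp_pos _).le (hg.nonneg x)) rfl (hg.tiltedJump_le β)
    (fun t => by
      rw [charFun_cramerTilt hg.integrableExpSet_tiltedJump h, hg.tiltedJump_zero_withDensity])
  have hφ : Measurable fun t : ℝ => (t - tiltMean ν β) / tiltSD ν β := by fun_prop
  have hσ' : tiltSD ν β ≠ 0 := by rw [hsd]; exact hσ.ne'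
  have hpt : standardizedTilt ν β {-(tiltMean ν β) / tiltSD ν β} = cramerTilt ν β {0} := by
    rw [standardizedTilt, Measure.map_apply hφ (measurableSet_singleton _)]
    congr 1
    ext t
    simp only [mem_preimage, mem_singleton_iff]
    rw [div_left_inj' hσ']
    constructor <;> intro h <;> linarith
  refine ⟨?_, fun y => le_max_right _ _, ?_, ?_⟩
  · unfold stdDensity
    fun_prop
  · rw [hpt, hatom]
    positivity
  · rw [hpt]
    conv_lhs => rw [standardizedTilt, heq, Measure.map_add _ _ hφ, Measure.map_smul,
      Measure.map_dirac' hφ]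
    congr 1
    · rw [zero_sub]
    · rw [hmean, hsd, map_withDensity_affine hcm hσ]
      rfl

end Main

/-! ### Assembly. -/

lemma exists_levyDensityBounds {g : ℝ → ℝ} {ε : ℝ} (hg_nonneg : ∀ x ∈ Icc (0 : ℝ) 1, 0 ≤ g x)
    (hg_piecewise : PiecewiseC 2 g 0 1) (hε : 0 < ε)
    (hg_lower : ∀ x ∈ Icc (0 : ℝ) 1 ∩ Icc (1 - ε) 1, ε ≤ g x) :
    ∃ M, LevyDensityBounds ((Icc (0 : ℝ) 1).indicator g) M ε := by
  obtain ⟨⟨F, hF, -, hcont⟩, M, hM⟩ := hg_piecewise.indicator_regular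
  refine ⟨max M 1, measurable_of_continuousAt_off_finite hF hcont,
    fun x => indicator_nonneg hg_nonneg x, fun x => ?_, fun x hx => indicator_of_notMem hx _,
    fun x hx hxε => ?_, le_max_right _ _, hε⟩
  · by_cases hx : x ∈ Icc (0 : ℝ) 1
    · rw [indicator_of_mem hx]
      exact (le_abs_self _).trans ((hM x hx).trans (le_max_left _ _))
    · rw [indicator_of_notMem hx]
      exact zero_le_one.trans (le_max_right _ _)
  · rw [indicator_of_mem hx]
    exact hg_lower x ⟨hx, hxε, hx.2⟩

/-- Only values of `g` on `[0,1]` enter, so the zero extension has the same exponent, which splits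
into the generating function and the mass of the untilted jump measure. -/
lemma HasLevyDensity.mgf_map {Ω : Type*} [MeasurableSpace Ω] {P : Measure Ω} {T : Ω → ℝ}
    {g : ℝ → ℝ} {M ε : ℝ} (hT : HasLevyDensity P T g)
    (hg : LevyDensityBounds ((Icc (0 : ℝ) 1).indicator g) M ε) (θ : ℝ) :
    mgf id (P.map T) θ = Real.exp (mgf id (tiltedJump ((Icc (0 : ℝ) 1).indicator g) 0) θ
      - (tiltedJump ((Icc (0 : ℝ) 1).indicator g) 0).real univ) := by
  rw [mgf_id_map hT.1, hT.2 θ, ← real_univ_exp_withDensity, hg.tiltedJump_zero_withDensity,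
    hg.real_univ_tiltedJump, hg.real_univ_tiltedJump,
    ← integral_sub (hg.integrable_tilted θ) (hg.integrable_tilted 0),
    intervalIntegral.integral_of_le zero_le_one, ← integral_Icc_eq_integral_Ioc,
    ← integral_indicator measurableSet_Icc]
  congr 1
  refine integral_congr_ae (Eventually.of_forall fun x => ?_)
  by_cases hx : x ∈ Icc (0 : ℝ) 1
  · simp only [indicator_of_mem hx, zero_mul, Real.exp_zero]
    ring
  · simp only [indicator_of_notMem hx, mul_zero, sub_zero]

/-- Local limit theorem for tilted sums. `f β` is the defective density of the standardized tilt
`Y_β`; it is taken continuous off a finite set and at all points `y` with `E_β + σ_β y > 1`, so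
that it is determined up to its values at finitely many points, and `f β 0` is determined as soon
as `E_β > 1`. -/
theorem mainTheorem1 {Ω : Type*} [MeasurableSpace Ω] (P : Measure Ω) [IsProbabilityMeasure P]
    (T : Ω → ℝ) (g : ℝ → ℝ) (ε : ℝ)
    (hg_nonneg : ∀ x ∈ Icc (0 : ℝ) 1, 0 ≤ g x)
    (hg_piecewise : PiecewiseC 2 g 0 1)
    (hε : 0 < ε)
    (hg_lower : ∀ x ∈ Icc (0 : ℝ) 1 ∩ Icc (1 - ε) 1, ε ≤ g x)
    (hT : HasLevyDensity P T g) :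
    Tendsto (fun β : ℝ => tiltMean (P.map T) β) atTop atTop ∧
    ∃ f : ℝ → ℝ → ℝ,
      (∀ β : ℝ,
        IsDefectiveDensity (standardizedTilt (P.map T) β)
          (-(tiltMean (P.map T) β) / tiltSD (P.map T) β) (f β) ∧
        (∃ F : Set ℝ, F.Finite ∧ ∀ y, y ∉ F → ContinuousAt (f β) y) ∧
        (∀ y : ℝ, 1 < tiltMean (P.map T) β + tiltSD (P.map T) β * y →
          ContinuousAt (f β) y)) ∧
      (∃ K : ℝ, ∀ᶠ β : ℝ in atTop, ∀ y : ℝ,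
        |f β y - 1 / Real.sqrt (2 * Real.pi) * Real.exp (-y ^ 2 / 2)|
          ≤ K * (1 / Real.sqrt (tiltMean (P.map T) β))) ∧
      (∃ K : ℝ, ∀ᶠ β : ℝ in atTop,
        |f β 0 - 1 / Real.sqrt (2 * Real.pi)| ≤ K * (1 / tiltMean (P.map T) β)) := by
  
  obtain ⟨M, hg⟩ := exists_levyDensityBounds hg_nonneg hg_piecewise hε hg_lower
  obtain ⟨⟨F, hF, hF01, hcont⟩, -⟩ := hg_piecewise.indicator_regular
  set g₁ := (Icc (0 : ℝ) 1).indicator g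
  have : IsProbabilityMeasure (P.map T) := Measure.isProbabilityMeasure_map hT.1
  have hmgf := hT.mgf_map hg
  have hmean : ∀ β, tiltMean (P.map T) β = LevyDensityBounds.jumpMean g₁ β := fun β => by
    rw [tiltMean_eq hg.integrableExpSet_tiltedJump hmgf, hg.tiltedJump_zero_withDensity]
    rfl
  have hsd : ∀ β, tiltSD (P.map T) β = LevyDensityBounds.jumpSD g₁ β := fun β => by
    rw [tiltSD, tiltVariance_eq hg.integrableExpSet_tiltedJump hmgf,
      hg.tiltedJump_zero_withDensity]
    rfl
  refine ⟨?_, LevyDensityBounds.stdDensity g₁, fun β =>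
    ⟨isDefectiveDensity_standardizedTilt hg hmgf hmean hsd β, ?_, fun y hy => ?_⟩, ?_⟩
  · simp_rw [hmean]
    exact hg.tendsto_jumpMean
  · have hσ := hg.jumpSD_pos β
    refine ⟨(fun y => LevyDensityBounds.jumpMean g₁ β + LevyDensityBounds.jumpSD g₁ β * y) ⁻¹' F,
      hF.preimage fun x _ y _ hxy => ?_, fun y hy => hg.continuousAt_stdDensity (hcont _ hy)⟩
    exact mul_left_cancel₀ hσ.ne' (add_left_cancel hxy)
  · rw [hmean, hsd] at hy
    -- The exceptional points of the zero extension lie in `[0,1]`, so every point beyond 1 is a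
    -- continuity point.
    exact hg.continuousAt_stdDensity (hcont _ fun h => (hF01 h).2.not_gt hy)
  · simp_rw [hmean]
    exact hg.exists_abs_stdDensity_sub_le
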